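/- Let $n\ge 1$, let $B^n$ and $S^{n-1}$ be the closed unit ball and the unit sphere of $\mathbb{R}^n$, and let $du$ be the (unnormalized) spherical Lebesgue measure on $S^{n-1}$. Let $\mathcal{K}^n_{(o)}$ be the set of compact convex sets $K\subset\mathbb{R}^n$ having the origin in their interior. For $K\in\mathcal{K}^n_{(o)}$ and $u\in S^{n-1}$ put $h_K(u)=\max_{x\in K}\langle x,u\rangle$, $\rho_K(u)=\max\{r\ge 0: ru\in K\}$, and $K^\circ=\{x\in\mathbb{R}^n:\langle x,y\rangle\le 1\text{ for all }y\in K\}$. Let $\varphi:(0,\infty)\to(0,\infty)$ be continuous and strictly increasing with $\lim_{t\to0^+}\varphi(t)=0$, $\varphi(1)=1$ and $\lim_{t\to\infty}\varphi(t)=\infty$. Let $\mu$ be a nonzero finite Borel measure on $S^{n-1}$ that is not concentrated on any closed hemisphere, i.e. $\mu(\{u:\langle u,v\rangle<0\})>0$ for all $v\in S^{n-1}$. Let $G:(0,\infty)\times S^{n-1}\to(0,\infty)$ be continuous and such that, for every $u\in S^{n-1}$, the function $t\mapsto G(t,u)$ is strictly increasing with $\lim_{t\to0^+}G(t,u)=0$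 and $\lim_{t\to\infty}G(t,u)=\infty$. Suppose that for some real $q\ge n-1$ $$\inf\Big\{\frac{G(t,u)}{t^q}:\ t\ge 1,\ u\in S^{n-1}\Big\}>0.$$ For $K,Q\in\mathcal{K}^n_{(o)}$ define $$\widetilde V_G(K)=\int_{S^{n-1}}G(\rho_K(u),u)\,du,\qquad \widehat V_G(K)=\inf\Big\{\eta>0:\int_{S^{n-1}}G\Big(\frac{\rho_K(u)}{\eta},u\Big)\,du\le 1\Big\},$$ $$\|h_Q\|_{\mu,\varphi}=\inf\Big\{\lambda>0:\frac1{\mu(S^{n-1})}\int_{S^{n-1}}\varphi\Big(\frac{h_Q(u)}{\lambda}\Big)\,d\mu(u)\le 1\Big\},$$ and let $\widetilde{\mathcal B}=\{Q\in\mathcal{K}^n_{(o)}:\widetilde V_G(Q^\circ)=\widetilde V_G(B^n)\}$ and $\widehat{\mathcal B}=\{Q\in\mathcal{K}^n_{(o)}:\widehat V_G(Q^\circ)=\widehat V_G(B^n)\}$. Then the following hold. i) There exists $\widetilde M\in\widetilde{\mathcal B}$ such that $\|h_{\widetilde M}\|_{\mu,\varphi}=\inf\{\|h_Q\|_{\mu,\varphi}:Q\in\widetilde{\mathcal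 B}\}$. If, in addition, $\varphi$ and $t\mapsto G(t,u)$ (for every $u\in S^{n-1}$) are convex on $(0,\infty)$, then such an $\widetilde M$ is unique. ii) There exists $\widehat M\in\widehat{\mathcal B}$ such that $\|h_{\widehat M}\|_{\mu,\varphi}=\inf\{\|h_Q\|_{\mu,\varphi}:Q\in\widehat{\mathcal B}\}$. If, in addition, $\varphi$ and $t\mapsto G(t,u)$ (for every $u\in S^{n-1}$) are convex on $(0,\infty)$, then such an $\widehat M$ is unique. -/

import Mathlib

open MeasureTheory Set Filter Topology
open scoped RealInnerProductSpace

noncomputable section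

namespace DualPolarOrlicz

/-- The Euclidean space `ℝⁿ`. -/
abbrev Space (n : ℕ) : Type := EuclideanSpace ℝ (Fin n)

/-- The unit sphere `S^{n-1}` of `ℝⁿ`. -/
abbrev Sph (n : ℕ) : Type := Metric.sphere (0 : Space n) 1

/-- The spherical (surface) measure `du` on `S^{n-1}`, not normalized: the measure of a Borel set
`A` is `n` times the volume of the cone over `A` with apex the origin. -/
def sphMeasure (n : ℕ) : Measure (Sph n) := (volume : Measure (Space n)).toSphere

/-- The compact convex subsets of `ℝⁿ` that have the origin in their interior. -/
def bodiesO (n : ℕ) : Set (ConvexBody (Space n)) :=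
  {K | (0 : Space n) ∈ interior (K : Set (Space n))}

/-- The support function `h_K(u) = max {⟨x, u⟩ : x ∈ K}` on the unit sphere. -/
def supportFn {n : ℕ} (K : Set (Space n)) (u : Sph n) : ℝ :=
  sSup ((fun x : Space n => ⟪x, (u : Space n)⟫) '' K)

/-- The radial function `ρ_K(u) = max {r ≥ 0 : r u ∈ K}` on the unit sphere. -/
def radialFn {n : ℕ} (K : Set (Space n)) (u : Sph n) : ℝ :=
  sSup {r : ℝ | 0 ≤ r ∧ r • (u : Space n) ∈ K}

/-- The polar set `K° = {x : ⟨x, y⟩ ≤ 1 for all y ∈ K}`. -/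
def polarBody {n : ℕ} (K : Set (Space n)) : Set (Space n) :=
  {x | ∀ y ∈ K, ⟪x, y⟫ ≤ 1}

/-- The class `𝓘` of continuous, strictly increasing functions `φ : (0, ∞) → (0, ∞)` with
`φ(0+) = 0`, `φ(1) = 1` and `φ(∞) = ∞`. Values of `φ` outside `(0, ∞)` play no role. -/
structure ClassI (φ : ℝ → ℝ) : Prop where
  continuousOn : ContinuousOn φ (Ioi 0)
  pos : ∀ t, 0 < t → 0 < φ t
  strictMonoOn : StrictMonoOn φ (Ioi 0)
  tendsto_zero : Tendsto φ (𝓝[>] 0) (𝓝 0)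
  map_one : φ 1 = 1
  tendsto_atTop : Tendsto φ atTop atTop

/-- The class `𝒢_I` of continuous functions `G : (0, ∞) × S^{n-1} → (0, ∞)` such that, for each
`u`, the function `G(·, u)` is strictly increasing, tends to `0` at `0+` and to `∞` at `∞`.
Values of `G(t, u)` for `t ≤ 0` play no role. -/
structure ClassGI {n : ℕ} (G : ℝ → Sph n → ℝ) : Prop where
  continuousOn : ContinuousOn (fun p : ℝ × Sph n => G p.1 p.2) (Ioi 0 ×ˢ univ)
  pos : ∀ t u, 0 < t → 0 < G t u
  strictMonoOn : ∀ u, StrictMonoOn (fun t => G t u) (Ioi 0)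
  tendsto_zero : ∀ u, Tendsto (fun t => G t u) (𝓝[>] 0) (𝓝 0)
  tendsto_atTop : ∀ u, Tendsto (fun t => G t u) atTop atTop

/-- The growth condition `inf {G(t, u) / t^q : t ≥ 1, u ∈ S^{n-1}} > 0`. -/
def GrowthCondition {n : ℕ} (G : ℝ → Sph n → ℝ) (q : ℝ) : Prop :=
  0 < sInf {x : ℝ | ∃ (t : ℝ) (u : Sph n), 1 ≤ t ∧ x = G t u / t ^ q}

/-- `μ` is not concentrated on any closed hemisphere `{u : ⟨u, v⟩ ≥ 0}` of `S^{n-1}`. -/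
def NotConcentratedOnHemisphere {n : ℕ} (μ : Measure (Sph n)) : Prop :=
  ∀ v : Sph n, μ {u : Sph n | 0 ≤ ⟪(u : Space n), (v : Space n)⟫}ᶜ ≠ 0

/-- The general dual volume `Ṽ_G(K) = ∫ G(ρ_K(u), u) du`. -/
def dualVol {n : ℕ} (G : ℝ → Sph n → ℝ) (K : Set (Space n)) : ℝ :=
  ∫ u, G (radialFn K u) u ∂(sphMeasure n)

/-- The homogeneous general dual volume of `K`, for `G` in the increasing class `𝒢_I`:
`V̂_G(K) = inf {η > 0 : ∫ G(ρ_K(u) / η, u) du ≤ 1}`. -/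
def homDualVol {n : ℕ} (G : ℝ → Sph n → ℝ) (K : Set (Space n)) : ℝ :=
  sInf {η : ℝ | 0 < η ∧ ∫ u, G (radialFn K u / η) u ∂(sphMeasure n) ≤ 1}

/-- The convex bodies `Q` with the origin in their interior and `Ṽ_G(Q°) = Ṽ_G(Bⁿ)`. -/
def constraintTilde {n : ℕ} (G : ℝ → Sph n → ℝ) : Set (ConvexBody (Space n)) :=
  {Q | Q ∈ bodiesO n ∧
    dualVol G (polarBody (Q : Set (Space n))) = dualVol G (Metric.closedBall (0 : Space n) 1)}

/-- The convex bodies `Q` with the origin in their interior and `V̂_G(Q°) = V̂_G(Bⁿ)`. -/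
def constraintHat {n : ℕ} (G : ℝ → Sph n → ℝ) : Set (ConvexBody (Space n)) :=
  {Q | Q ∈ bodiesO n ∧
    homDualVol G (polarBody (Q : Set (Space n))) =
      homDualVol G (Metric.closedBall (0 : Space n) 1)}

/-- The Orlicz norm, for `φ` in the increasing class `𝓘`, of a positive function `f` on the sphere:
`‖f‖_{μ,φ} = inf {s > 0 : (1 / μ(S^{n-1})) ∫ φ(f(u) / s) dμ(u) ≤ 1}`. -/
def orliczNorm {n : ℕ} (μ : Measure (Sph n)) (φ : ℝ → ℝ) (f : Sph n → ℝ) : ℝ :=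
  sInf {s : ℝ | 0 < s ∧ 1 / μ.real univ * ∫ u, φ (f u / s) ∂μ ≤ 1}

/-- `M` solves the problem `inf {‖h_Q‖_{μ,φ} : Q ∈ 𝓑}`: it belongs to `𝓑` and attains the
infimum. -/
def IsSolution {n : ℕ} (μ : Measure (Sph n)) (φ : ℝ → ℝ) (B : Set (ConvexBody (Space n)))
    (M : ConvexBody (Space n)) : Prop :=
  M ∈ B ∧ orliczNorm μ φ (supportFn (M : Set (Space n))) =
    sInf ((fun Q : ConvexBody (Space n) => orliczNorm μ φ (supportFn (Q : Set (Space n)))) '' B)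

end DualPolarOrlicz

end

namespace DualPolarOrlicz

/-! Since `ρ_{Q°} = 1 / h_Q`, both constraints have the form `∫ G(1 / h_Q(u), u) du = c`
(`levelSet`). The homogeneous one becomes this after `G(t, u)` is replaced by `G(t / s, u)` with `s`
the homogeneous dual volume of the ball. The Orlicz norm and the homogeneous dual volume are both
Luxemburg functionals: roots `s` of `∫ G(f / s, u) dν = 1`.

Existence is the direct method. Along a minimizing sequence the norms are bounded; as `μ` charges
all open hemispheres uniformly, the bodies lie in one ball (`exists_forall_subset_closedBall`), and
Blaschke selection gives a limit `M`. The danger is that the origin lies on the boundary of `M`,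
that is, `h_M(v) = 0` for some `v`. As `h_M` is Lipschitz, `1 / h_M` is then at least a multiple of
`1 / d(u, v)`, and growth of order `n - 1` makes `G(1 / h_M(u), u)` dominate a multiple of `d(u, v)
^ (-(n - 1))` near `v`, which is not integrable on an `(n - 1)`-dimensional sphere. This contradicts
Fatou (`supportFn_pos_of_tendsto`). With the origin interior, constraint and norm pass to the limit.

For uniqueness, let `K ≠ L` be two minimizers. Convexity of `φ` shows that their midpoint has no
larger norm, while strict convexity of `1 / t` puts its integral strictly below `c`. Shrinking it by
a factor `s < 1` restores the constraint and lowers the norm, a contradiction. -/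

variable {n : ℕ}

/-! ### Support functions and radial functions of polars. -/

theorem supportFn_bddAbove (K : ConvexBody (Space n)) (u : Sph n) :
    BddAbove ((fun x : Space n => ⟪x, (u : Space n)⟫) '' (K : Set (Space n))) :=
  (K.isCompact.image (by fun_prop)).bddAbove

theorem inner_le_supportFn (K : ConvexBody (Space n)) {x : Space n} (hx : x ∈ K) (u : Sph n) :
    ⟪x, (u : Space n)⟫ ≤ supportFn (K : Set (Space n)) u :=
  le_csSup (supportFn_bddAbove K u) ⟨x, hx, rfl⟩

theorem supportFn_le (K : ConvexBody (Space n)) (u : Sph n) {c : ℝ}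
    (h : ∀ x ∈ K, ⟪x, (u : Space n)⟫ ≤ c) : supportFn (K : Set (Space n)) u ≤ c := by
  refine csSup_le (K.nonempty.image _) ?_
  rintro _ ⟨x, hx, rfl⟩
  exact h x hx

theorem supportFn_add (K L : ConvexBody (Space n)) (u : Sph n) :
    supportFn ((K + L : ConvexBody (Space n)) : Set (Space n)) u =
      supportFn (K : Set (Space n)) u + supportFn (L : Set (Space n)) u := by
  apply le_antisymm
  · refine supportFn_le _ u fun z hz => ?_
    rw [← SetLike.mem_coe, ConvexBody.coe_add] at hz
    obtain ⟨x, hx, y, hy, rfl⟩ := hz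
    rw [inner_add_left]
    exact add_le_add (inner_le_supportFn K hx u) (inner_le_supportFn L hy u)
  · rw [← le_sub_iff_add_le]
    refine supportFn_le _ u fun x hx => ?_
    rw [le_sub_comm]
    refine supportFn_le _ u fun y hy => ?_
    rw [le_sub_iff_add_le', ← inner_add_left]
    refine inner_le_supportFn _ ?_ u
    rw [← SetLike.mem_coe, ConvexBody.coe_add]
    exact ⟨x, hx, y, hy, rfl⟩

theorem supportFn_smul (K : ConvexBody (Space n)) {c : ℝ} (hc : 0 < c) (u : Sph n) :
    supportFn ((c • K : ConvexBody (Space n)) : Set (Space n)) u =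
      c * supportFn (K : Set (Space n)) u := by
  apply le_antisymm
  · refine supportFn_le _ u fun z hz => ?_
    rw [← SetLike.mem_coe, ConvexBody.coe_smul] at hz
    obtain ⟨x, hx, rfl⟩ := hz
    simp only [real_inner_smul_left]
    exact mul_le_mul_of_nonneg_left (inner_le_supportFn K hx u) hc.le
  · rw [← le_div_iff₀' hc]
    refine supportFn_le _ u fun x hx => ?_
    rw [le_div_iff₀' hc, ← real_inner_smul_left]
    refine inner_le_supportFn _ ?_ u
    rw [← SetLike.mem_coe, ConvexBody.coe_smul]
    exact ⟨x, hx, rfl⟩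

theorem supportFn_le_add_dist (K L : ConvexBody (Space n)) (u : Sph n) :
    supportFn (K : Set (Space n)) u ≤ supportFn (L : Set (Space n)) u + dist K L := by
  refine supportFn_le _ u fun x hx => ?_
  refine le_of_forall_pos_le_add fun ε hε => ?_
  obtain ⟨y, hy, hxy⟩ := Metric.exists_dist_lt_of_hausdorffDist_lt (r := dist K L + ε) hx
    (by rw [ConvexBody.hausdorffDist_coe]; linarith) ConvexBody.hausdorffEDist_ne_top
  have h1 : ⟪x - y, (u : Space n)⟫ ≤ ‖x - y‖ := by
    simpa using real_inner_le_norm (x - y) (u : Space n)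
  rw [inner_sub_left] at h1
  rw [dist_eq_norm] at hxy
  linarith [inner_le_supportFn L hy u]

theorem abs_supportFn_sub_le_dist (K L : ConvexBody (Space n)) (u : Sph n) :
    |supportFn (K : Set (Space n)) u - supportFn (L : Set (Space n)) u| ≤ dist K L := by
  rw [abs_le]
  have h1 := supportFn_le_add_dist K L u
  have h2 := supportFn_le_add_dist L K u
  rw [dist_comm L K] at h2
  constructor <;> linarith

theorem supportFn_le_add_mul_dist {K : ConvexBody (Space n)} {R : ℝ}
    (hK : (K : Set (Space n)) ⊆ Metric.closedBall 0 R) (u v : Sph n) :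
    supportFn (K : Set (Space n)) u ≤ supportFn (K : Set (Space n)) v + R * dist u v := by
  refine supportFn_le _ u fun x hx => ?_
  have h1 : ⟪x, (u : Space n) - v⟫ ≤ ‖x‖ * ‖(u : Space n) - v‖ := real_inner_le_norm _ _
  have h2 : ‖x‖ ≤ R := by simpa using hK hx
  rw [inner_sub_right] at h1
  have h3 : dist u v = ‖(u : Space n) - v‖ := by rw [Subtype.dist_eq, dist_eq_norm]
  have h4 := mul_le_mul_of_nonneg_right h2 (norm_nonneg ((u : Space n) - v))
  rw [h3]
  linarith [inner_le_supportFn K hx v]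

theorem exists_subset_closedBall (K : ConvexBody (Space n)) :
    ∃ R, 0 < R ∧ (K : Set (Space n)) ⊆ Metric.closedBall 0 R := by
  obtain ⟨R, hR, h⟩ := K.isBounded.subset_closedBall_lt 0 0
  exact ⟨R, hR, h⟩

theorem continuous_supportFn (K : ConvexBody (Space n)) :
    Continuous (supportFn (K : Set (Space n)) : Sph n → ℝ) := by
  obtain ⟨R, hR, h⟩ := exists_subset_closedBall K
  refine (LipschitzWith.of_le_add_mul R.toNNReal fun u v => ?_).continuous
  rw [Real.coe_toNNReal _ hR.le]
  exact supportFn_le_add_mul_dist h u v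

/-- Hahn–Banach separation, with the functional turned into a vector by Riesz and normalized. Hence
a body is determined by its support function, and positivity of the latter detects an interior
origin. -/
theorem exists_supportFn_lt_inner {K : ConvexBody (Space n)} {x : Space n} (hx : x ∉ K) :
    ∃ u : Sph n, supportFn (K : Set (Space n)) u < ⟪x, (u : Space n)⟫ := by
  obtain ⟨f, s, hs, hfx⟩ := geometric_hahn_banach_closed_point K.convex K.isClosed hx
  set w := (InnerProductSpace.toDual ℝ (Space n)).symm f with hw
  have hf : ∀ y, f y = ⟪y, w⟫ := fun y => by
    rw [real_inner_comm, hw, InnerProductSpace.toDual_symm_apply]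
  have hw0 : w ≠ 0 := by
    intro h0
    obtain ⟨a, ha⟩ := K.nonempty
    have := hs a ha
    rw [hf, h0, inner_zero_right] at this hfx
    linarith
  have hwn : 0 < ‖w‖ := norm_pos_iff.2 hw0
  refine ⟨⟨‖w‖⁻¹ • w, by simp [norm_smul, hwn.ne']⟩, ?_⟩
  refine lt_of_le_of_lt (supportFn_le (c := ‖w‖⁻¹ * s) K _ fun y hy => ?_) ?_
  · simp only [real_inner_smul_right, ← hf]
    exact mul_le_mul_of_nonneg_left (hs y hy).le (by positivity)
  · simp only [real_inner_smul_right, ← hf]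
    exact mul_lt_mul_of_pos_left hfx (by positivity)

theorem eq_of_supportFn_eq {K L : ConvexBody (Space n)}
    (h : ∀ u, supportFn (K : Set (Space n)) u = supportFn (L : Set (Space n)) u) : K = L := by
  have key : ∀ K L : ConvexBody (Space n),
      (∀ u, supportFn (K : Set (Space n)) u = supportFn (L : Set (Space n)) u) →
      (K : Set (Space n)) ⊆ L := by
    intro K L h x hx
    by_contra hxL
    obtain ⟨u, hu⟩ := exists_supportFn_lt_inner hxL
    linarith [inner_le_supportFn K hx u, h u]
  exact ConvexBody.ext (subset_antisymm (key K L h) (key L K fun u => (h u).symm))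

theorem supportFn_nonneg {K : ConvexBody (Space n)} (h : (0 : Space n) ∈ K) (u : Sph n) :
    0 ≤ supportFn (K : Set (Space n)) u := by
  simpa using inner_le_supportFn K h u

theorem supportFn_pos {K : ConvexBody (Space n)} (h : K ∈ bodiesO n) (u : Sph n) :
    0 < supportFn (K : Set (Space n)) u := by
  obtain ⟨r, hr, hb⟩ := Metric.isOpen_iff.1 isOpen_interior _ h
  have hmem : (r / 2) • (u : Space n) ∈ K := by
    refine interior_subset (hb ?_)
    simp [norm_smul, abs_of_pos hr, hr]
  have := inner_le_supportFn K hmem u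
  rw [real_inner_smul_left, real_inner_self_eq_norm_sq] at this
  have hu : ‖(u : Space n)‖ = 1 := by simp
  rw [hu] at this
  linarith

theorem mem_bodiesO_of_supportFn_ge {K : ConvexBody (Space n)} {r : ℝ} (hr : 0 < r)
    (h : ∀ u, r ≤ supportFn (K : Set (Space n)) u) : K ∈ bodiesO n := by
  refine mem_interior.2 ⟨Metric.ball 0 r, fun x hx => ?_, Metric.isOpen_ball, by simpa⟩
  by_contra hxK
  obtain ⟨u, hu⟩ := exists_supportFn_lt_inner hxK
  have h1 := real_inner_le_norm x (u : Space n)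
  have hun : ‖(u : Space n)‖ = 1 := by simp
  have h2 : ‖x‖ < r := by simpa using hx
  rw [hun] at h1
  linarith [h u]

theorem exists_forall_le_of_pos {α : Type*} [TopologicalSpace α] [CompactSpace α] {f : α → ℝ}
    (hf : Continuous f) (hpos : ∀ u, 0 < f u) : ∃ r, 0 < r ∧ ∀ u, r ≤ f u := by
  rcases isEmpty_or_nonempty α with hα | hα
  · exact ⟨1, one_pos, fun u => (hα.false u).elim⟩
  · obtain ⟨u, -, hu⟩ := isCompact_univ.exists_isMinOn univ_nonempty hf.continuousOn
    exact ⟨f u, hpos u, fun w => hu (mem_univ w)⟩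

theorem mem_bodiesO_iff {K : ConvexBody (Space n)} :
    K ∈ bodiesO n ↔ ∀ u, 0 < supportFn (K : Set (Space n)) u := by
  refine ⟨supportFn_pos, fun h => ?_⟩
  obtain ⟨r, hr, hle⟩ := exists_forall_le_of_pos (continuous_supportFn K) h
  exact mem_bodiesO_of_supportFn_ge hr hle

/-- The ray through `u` meets the polar in a segment of length `1 / h_K(u)`. This makes the
constraints conditions on the support function alone. -/
theorem radialFn_polarBody {K : ConvexBody (Space n)} (h : K ∈ bodiesO n) (u : Sph n) :
    radialFn (polarBody (K : Set (Space n))) u = (supportFn (K : Set (Space n)) u)⁻¹ := by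
  have hpos := supportFn_pos h u
  have : {r : ℝ | 0 ≤ r ∧ r • (u : Space n) ∈ polarBody (K : Set (Space n))} =
      Icc 0 (supportFn (K : Set (Space n)) u)⁻¹ := by
    ext r
    simp only [polarBody, mem_ofPred_eq, mem_Icc, real_inner_smul_left]
    refine and_congr_right fun hr => ⟨fun H => ?_, fun H y hy => ?_⟩
    · rcases hr.eq_or_lt with rfl | hr
      · positivity
      · rw [le_inv_comm₀ hr hpos]
        refine supportFn_le _ u fun y hy => ?_
        rw [real_inner_comm, ← one_div, le_div_iff₀' hr]
        exact H y hy
    · rw [real_inner_comm]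
      calc r * ⟪y, (u : Space n)⟫ ≤ r * supportFn (K : Set (Space n)) u :=
            mul_le_mul_of_nonneg_left (inner_le_supportFn K hy u) hr
        _ ≤ (supportFn (K : Set (Space n)) u)⁻¹ * supportFn (K : Set (Space n)) u :=
            mul_le_mul_of_nonneg_right H hpos.le
        _ = 1 := inv_mul_cancel₀ hpos.ne'
  rw [radialFn, this, csSup_Icc (by positivity)]

theorem radialFn_closedBall (u : Sph n) :
    radialFn (Metric.closedBall (0 : Space n) 1) u = 1 := by
  have : {r : ℝ | 0 ≤ r ∧ r • (u : Space n) ∈ Metric.closedBall (0 : Space n) 1} = Icc 0 1 := by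
    ext r
    simp only [mem_ofPred_eq, mem_Icc, mem_closedBall_zero_iff, norm_smul, Real.norm_eq_abs]
    refine and_congr_right fun hr => ?_
    simp [abs_of_nonneg hr]
  rw [radialFn, this, csSup_Icc zero_le_one]

/-- The closed unit ball, as a convex body. -/
noncomputable def unitBall (n : ℕ) : ConvexBody (Space n) where
  carrier := Metric.closedBall 0 1
  convex' := convex_closedBall 0 1
  isCompact' := isCompact_closedBall 0 1
  nonempty' := ⟨0, by simp⟩

theorem unitBall_mem_bodiesO : unitBall n ∈ bodiesO n :=
  mem_interior.2 ⟨Metric.ball 0 1, Metric.ball_subset_closedBall, Metric.isOpen_ball, by simp⟩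

theorem supportFn_unitBall (u : Sph n) : supportFn (unitBall n : Set (Space n)) u = 1 := by
  have hu : ‖(u : Space n)‖ = 1 := by simp
  apply le_antisymm
  · refine supportFn_le _ u fun x hx => ?_
    have hx : ‖x‖ ≤ 1 := by
      have : x ∈ Metric.closedBall (0 : Space n) 1 := hx
      simpa using this
    have := real_inner_le_norm x (u : Space n)
    rw [hu] at this
    linarith
  · have hmem : (u : Space n) ∈ unitBall n := by
      change (u : Space n) ∈ Metric.closedBall (0 : Space n) 1
      simp
    have := inner_le_supportFn _ hmem u
    rwa [real_inner_self_eq_norm_sq, hu, one_pow] at this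


/-! ### Luxemburg functionals. -/

/-- The Luxemburg-type functional `inf {s > 0 : ∫ G(f(u) / s, u) dν ≤ 1}`. -/
noncomputable def luxemburg (ν : Measure (Sph n)) (G : ℝ → Sph n → ℝ) (f : Sph n → ℝ) : ℝ :=
  sInf {s : ℝ | 0 < s ∧ ∫ u, G (f u / s) u ∂ν ≤ 1}

section

variable {ν : Measure (Sph n)} [IsFiniteMeasure ν] {G : ℝ → Sph n → ℝ} {f g : Sph n → ℝ}

theorem ClassGI.continuous_comp (hG : ClassGI G) (hf : Continuous f) (hpos : ∀ u, 0 < f u) :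
    Continuous fun u => G (f u) u :=
  hG.continuousOn.comp_continuous (f := fun u => (f u, u)) (by fun_prop)
    fun u => ⟨hpos u, mem_univ u⟩

theorem integrable_of_continuous (hf : Continuous f) : Integrable f ν :=
  hf.integrable_of_hasCompactSupport (HasCompactSupport.of_compactSpace f)

theorem ClassGI.integrable_comp (hG : ClassGI G) (hf : Continuous f) (hpos : ∀ u, 0 < f u) :
    Integrable (fun u => G (f u) u) ν :=
  integrable_of_continuous (hG.continuous_comp hf hpos)

theorem ClassGI.mono (hG : ClassGI G) {s t : ℝ} (hs : 0 < s) (hst : s ≤ t) (u : Sph n) :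
    G s u ≤ G t u :=
  (hG.strictMonoOn u).monotoneOn (mem_Ioi.2 hs) (mem_Ioi.2 (hs.trans_le hst)) hst

theorem ClassGI.integral_mono (hG : ClassGI G) (hf : Continuous f) (hpos : ∀ u, 0 < f u)
    (hg : Continuous g) (hfg : ∀ u, f u ≤ g u) :
    ∫ u, G (f u) u ∂ν ≤ ∫ u, G (g u) u ∂ν :=
  MeasureTheory.integral_mono (hG.integrable_comp hf hpos)
    (hG.integrable_comp hg fun u => (hpos u).trans_le (hfg u))
    fun u => hG.mono (hpos u) (hfg u) u

omit [IsFiniteMeasure ν] in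
theorem integral_lt_of_forall_lt [NeZero ν] (hf : Integrable f ν) (hg : Integrable g ν)
    (h : ∀ u, f u < g u) : ∫ u, f u ∂ν < ∫ u, g u ∂ν := by
  have h0 : 0 < ∫ u, (g u - f u) ∂ν := by
    rw [integral_pos_iff_support_of_nonneg (fun u => (sub_pos.2 (h u)).le) (hg.sub hf)]
    have : Function.support (fun u => g u - f u) = univ :=
      eq_univ_of_forall fun u => (sub_pos.2 (h u)).ne'
    rw [this]
    exact Measure.measure_univ_pos.2 (NeZero.ne ν)
  rw [integral_sub hg hf] at h0
  linarith

theorem ClassGI.integral_lt [NeZero ν] (hG : ClassGI G) (hf : Continuous f)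
    (hpos : ∀ u, 0 < f u) (hg : Continuous g) (hfg : ∀ u, f u < g u) :
    ∫ u, G (f u) u ∂ν < ∫ u, G (g u) u ∂ν :=
  integral_lt_of_forall_lt (hG.integrable_comp hf hpos)
    (hG.integrable_comp hg fun u => (hpos u).trans (hfg u))
    fun u => hG.strictMonoOn u (mem_Ioi.2 (hpos u)) (mem_Ioi.2 ((hpos u).trans (hfg u))) (hfg u)

theorem ClassGI.const_mul (hG : ClassGI G) {c : ℝ} (hc : 0 < c) :
    ClassGI fun t (u : Sph n) => c * G t u where
  continuousOn := continuousOn_const.mul hG.continuousOn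
  pos t u ht := mul_pos hc (hG.pos t u ht)
  strictMonoOn u _ hs _ ht hst := mul_lt_mul_of_pos_left (hG.strictMonoOn u hs ht hst) hc
  tendsto_zero u := by simpa using (hG.tendsto_zero u).const_mul c
  tendsto_atTop u := (hG.tendsto_atTop u).const_mul_atTop hc

theorem ClassGI.comp_div (hG : ClassGI G) {c : ℝ} (hc : 0 < c) :
    ClassGI fun t (u : Sph n) => G (t / c) u where
  continuousOn := by
    refine hG.continuousOn.comp (f := fun p : ℝ × Sph n => (p.1 / c, p.2)) (by fun_prop) ?_
    rintro ⟨t, u⟩ ⟨ht, -⟩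
    exact ⟨div_pos ht hc, mem_univ u⟩
  pos t u ht := hG.pos _ u (div_pos ht hc)
  strictMonoOn u _ hs _ ht hst := hG.strictMonoOn u (mem_Ioi.2 (div_pos hs hc))
    (mem_Ioi.2 (div_pos ht hc)) (div_lt_div_of_pos_right hst hc)
  tendsto_zero u := by
    refine (hG.tendsto_zero u).comp (tendsto_nhdsWithin_iff.2 ⟨?_, ?_⟩)
    · have : Tendsto (fun t : ℝ => t / c) (𝓝 0) (𝓝 (0 / c)) := tendsto_id.div_const c
      rw [zero_div] at this
      exact this.mono_left nhdsWithin_le_nhds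
    · filter_upwards [self_mem_nhdsWithin] with t ht using div_pos ht hc
  tendsto_atTop u := (hG.tendsto_atTop u).comp (tendsto_id.atTop_div_const hc)

theorem ClassI.classGI {φ : ℝ → ℝ} (hφ : ClassI φ) : ClassGI fun t (_ : Sph n) => φ t where
  continuousOn := hφ.continuousOn.comp continuousOn_fst fun _ hp => hp.1
  pos t _ ht := hφ.pos t ht
  strictMonoOn _ := hφ.strictMonoOn
  tendsto_zero _ := hφ.tendsto_zero
  tendsto_atTop _ := hφ.tendsto_atTop

theorem ClassGI.continuousOn_integral_div (hG : ClassGI G) (hf : Continuous f)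
    (hpos : ∀ u, 0 < f u) : ContinuousOn (fun s => ∫ u, G (f u / s) u ∂ν) (Ioi 0) := by
  intro s hs
  rw [mem_Ioi] at hs
  have hs2 : 0 < s / 2 := half_pos hs
  refine ContinuousAt.continuousWithinAt ?_
  have hev : ∀ᶠ t in 𝓝 s, s / 2 < t := lt_mem_nhds (half_lt_self hs)
  refine tendsto_integral_filter_of_dominated_convergence (fun u => G (f u / (s / 2)) u)
    ?_ ?_ ?_ ?_
  · filter_upwards [hev] with t ht
    exact (hG.integrable_comp (hf.div_const t)
      fun u => div_pos (hpos u) (hs2.trans ht)).aestronglyMeasurable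
  · filter_upwards [hev] with t ht
    refine Eventually.of_forall fun u => ?_
    have h1 : 0 < f u / t := div_pos (hpos u) (hs2.trans ht)
    rw [Real.norm_eq_abs, abs_of_pos (hG.pos _ u h1)]
    exact hG.mono h1 (div_le_div_of_nonneg_left (hpos u).le hs2 ht.le) u
  · exact hG.integrable_comp (hf.div_const _) fun u => div_pos (hpos u) hs2
  · refine Eventually.of_forall fun u => ?_
    have hc : ContinuousAt (fun p : ℝ × Sph n => G p.1 p.2) (f u / s, u) :=
      hG.continuousOn.continuousAt
        ((isOpen_Ioi.prod isOpen_univ).mem_nhds ⟨div_pos (hpos u) hs, mem_univ u⟩)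
    exact hc.tendsto.comp ((tendsto_const_nhds.div tendsto_id hs.ne').prodMk_nhds
      tendsto_const_nhds)

theorem ClassGI.exists_integral_div_lt (hG : ClassGI G) (hf : Continuous f)
    (hpos : ∀ u, 0 < f u) {c : ℝ} (hc : 0 < c) : ∃ s, 0 < s ∧ ∫ u, G (f u / s) u ∂ν < c := by
  have hlim : Tendsto (fun s => ∫ u, G (f u / s) u ∂ν) atTop (𝓝 (∫ _, (0 : ℝ) ∂ν)) := by
    refine tendsto_integral_filter_of_dominated_convergence (fun u => G (f u) u) ?_ ?_ ?_ ?_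
    · filter_upwards [eventually_gt_atTop 0] with t ht
      exact (hG.integrable_comp (hf.div_const t)
        fun u => div_pos (hpos u) ht).aestronglyMeasurable
    · filter_upwards [eventually_ge_atTop 1] with t ht
      refine Eventually.of_forall fun u => ?_
      have h1 : 0 < f u / t := div_pos (hpos u) (by linarith)
      rw [Real.norm_eq_abs, abs_of_pos (hG.pos _ u h1)]
      exact hG.mono h1 (div_le_self (hpos u).le ht) u
    · exact hG.integrable_comp hf hpos
    · refine Eventually.of_forall fun u => (hG.tendsto_zero u).comp ?_
      refine tendsto_nhdsWithin_iff.2 ⟨tendsto_const_nhds.div_atTop tendsto_id, ?_⟩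
      filter_upwards [eventually_gt_atTop 0] with t ht using div_pos (hpos u) ht
  rw [integral_zero] at hlim
  obtain ⟨s, hs, hs0⟩ := ((hlim.eventually_lt_const hc).and (eventually_gt_atTop 0)).exists
  exact ⟨s, hs0, hs⟩

theorem ClassGI.exists_lt_integral_div [NeZero ν] (hG : ClassGI G) (hf : Continuous f)
    (hpos : ∀ u, 0 < f u) (c : ℝ) : ∃ s, 0 < s ∧ c < ∫ u, G (f u / s) u ∂ν := by
  have hν : 0 < ν.real univ := measureReal_univ_pos
  -- Truncating at `C` allows dominated convergence as `k → ∞`; the truncated integrals tend to `C *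
  -- ν(univ) = |c| + 1 > c`.
  set C : ℝ := (|c| + 1) / ν.real univ with hC
  have hC0 : 0 < C := by positivity
  have hdiv : ∀ k : ℝ, 0 < k → Continuous fun u => G (f u / k⁻¹) u := fun k hk =>
    hG.continuous_comp (hf.div_const _) fun u => div_pos (hpos u) (inv_pos.2 hk)
  have hlim : Tendsto (fun k : ℝ => ∫ u, min (G (f u / k⁻¹) u) C ∂ν) atTop
      (𝓝 (∫ _, C ∂ν)) := by
    refine tendsto_integral_filter_of_dominated_convergence (fun _ => C) ?_ ?_ ?_ ?_
    · filter_upwards [eventually_gt_atTop 0] with k hk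
      exact ((hdiv k hk).min continuous_const).aestronglyMeasurable
    · filter_upwards [eventually_gt_atTop 0] with k hk
      refine Eventually.of_forall fun u => ?_
      have h1 := hG.pos _ u (div_pos (hpos u) (inv_pos.2 hk))
      rw [Real.norm_eq_abs, abs_of_pos (lt_min h1 hC0)]
      exact min_le_right _ _
    · exact integrable_const _
    · refine Eventually.of_forall fun u => ?_
      have h1 : Tendsto (fun k : ℝ => G (f u / k⁻¹) u) atTop atTop := by
        refine (hG.tendsto_atTop u).comp ?_
        simp only [div_inv_eq_mul]
        exact tendsto_id.const_mul_atTop (hpos u)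
      refine tendsto_const_nhds.congr' ?_
      filter_upwards [h1.eventually_ge_atTop C] with k hk using (min_eq_right hk).symm
  have hval : ∫ _, C ∂ν = |c| + 1 := by
    rw [integral_const, smul_eq_mul, hC]
    field_simp
  rw [hval] at hlim
  have hlt : c < |c| + 1 := by linarith [le_abs_self c]
  obtain ⟨k, hk, hk0⟩ := ((hlim.eventually_const_lt hlt).and (eventually_gt_atTop 0)).exists
  refine ⟨k⁻¹, inv_pos.2 hk0, hk.trans_le ?_⟩
  exact MeasureTheory.integral_mono
    (integrable_of_continuous ((hdiv k hk0).min continuous_const))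
    (integrable_of_continuous (hdiv k hk0)) fun u => min_le_left _ _

theorem ClassGI.exists_integral_div_eq [NeZero ν] (hG : ClassGI G) (hf : Continuous f)
    (hpos : ∀ u, 0 < f u) {c : ℝ} (hc : 0 < c) : ∃ s, 0 < s ∧ ∫ u, G (f u / s) u ∂ν = c := by
  obtain ⟨s, hs, hs'⟩ := hG.exists_integral_div_lt (ν := ν) hf hpos hc
  obtain ⟨t, ht, ht'⟩ := hG.exists_lt_integral_div (ν := ν) hf hpos c
  obtain ⟨r, hr, h⟩ := isPreconnected_Ioi.intermediate_value hs ht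
    (hG.continuousOn_integral_div (ν := ν) hf hpos) ⟨hs'.le, ht'.le⟩
  exact ⟨r, hr, h⟩

theorem ClassGI.integral_div_lt_iff [NeZero ν] (hG : ClassGI G) (hf : Continuous f)
    (hpos : ∀ u, 0 < f u) {s t : ℝ} (hs : 0 < s) (ht : 0 < t) :
    ∫ u, G (f u / s) u ∂ν < ∫ u, G (f u / t) u ∂ν ↔ t < s := by
  have key : ∀ {s t : ℝ}, 0 < t → t < s →
      ∫ u, G (f u / s) u ∂ν < ∫ u, G (f u / t) u ∂ν := fun {s t} ht h =>
    hG.integral_lt (hf.div_const s) (fun u => div_pos (hpos u) (ht.trans h)) (hf.div_const t)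
      fun u => div_lt_div_of_pos_left (hpos u) ht h
  refine ⟨fun h => ?_, key ht⟩
  by_contra! hst
  rcases hst.eq_or_lt with rfl | hst
  · exact lt_irrefl _ h
  · exact lt_asymm h (key hs hst)

/-- The integral is strictly decreasing in the parameter, so the set defining the infimum is exactly
`Ici s`. -/
theorem luxemburg_eq_of_integral_eq [NeZero ν] (hG : ClassGI G) (hf : Continuous f)
    (hpos : ∀ u, 0 < f u) {s : ℝ} (hs : 0 < s) (h : ∫ u, G (f u / s) u ∂ν = 1) :
    luxemburg ν G f = s := by
  have : {t : ℝ | 0 < t ∧ ∫ u, G (f u / t) u ∂ν ≤ 1} = Ici s := by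
    ext t
    refine ⟨fun ⟨ht, hle⟩ => ?_, fun hst => ?_⟩
    · by_contra hlt
      have := (hG.integral_div_lt_iff (ν := ν) hf hpos hs ht).2 (not_le.1 hlt)
      linarith
    · have ht : 0 < t := hs.trans_le hst
      refine ⟨ht, not_lt.1 fun hlt => ?_⟩
      exact not_le.2 ((hG.integral_div_lt_iff (ν := ν) hf hpos hs ht).1 (h.trans_lt hlt)) hst
  rw [luxemburg, this, csInf_Ici]

theorem luxemburg_spec [NeZero ν] (hG : ClassGI G) (hf : Continuous f) (hpos : ∀ u, 0 < f u) :
    0 < luxemburg ν G f ∧ ∫ u, G (f u / luxemburg ν G f) u ∂ν = 1 := by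
  obtain ⟨s, hs, h⟩ := hG.exists_integral_div_eq (ν := ν) hf hpos one_pos
  rw [luxemburg_eq_of_integral_eq hG hf hpos hs h]
  exact ⟨hs, h⟩

theorem luxemburg_le_iff [NeZero ν] (hG : ClassGI G) (hf : Continuous f) (hpos : ∀ u, 0 < f u)
    {s : ℝ} (hs : 0 < s) : luxemburg ν G f ≤ s ↔ ∫ u, G (f u / s) u ∂ν ≤ 1 := by
  obtain ⟨h0, h1⟩ := luxemburg_spec (ν := ν) hG hf hpos
  rw [← not_lt, ← not_lt, not_iff_not, ← hG.integral_div_lt_iff (ν := ν) hf hpos h0 hs, h1]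

theorem luxemburg_eq_iff [NeZero ν] (hG : ClassGI G) (hf : Continuous f) (hpos : ∀ u, 0 < f u)
    {s : ℝ} (hs : 0 < s) : luxemburg ν G f = s ↔ ∫ u, G (f u / s) u ∂ν = 1 :=
  ⟨fun h => h ▸ (luxemburg_spec (ν := ν) hG hf hpos).2,
    luxemburg_eq_of_integral_eq hG hf hpos hs⟩

theorem luxemburg_mono [NeZero ν] (hG : ClassGI G) (hf : Continuous f) (hpos : ∀ u, 0 < f u)
    (hg : Continuous g) (hfg : ∀ u, f u ≤ g u) : luxemburg ν G f ≤ luxemburg ν G g := by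
  have hgpos : ∀ u, 0 < g u := fun u => (hpos u).trans_le (hfg u)
  obtain ⟨h0, h1⟩ := luxemburg_spec (ν := ν) hG hg hgpos
  rw [luxemburg_le_iff hG hf hpos h0]
  refine le_trans ?_ h1.le
  exact hG.integral_mono (hf.div_const _) (fun u => div_pos (hpos u) h0) (hg.div_const _)
    fun u => div_le_div_of_nonneg_right (hfg u) h0.le

theorem luxemburg_const_mul [NeZero ν] (hG : ClassGI G) (hf : Continuous f)
    (hpos : ∀ u, 0 < f u) {c : ℝ} (hc : 0 < c) :
    luxemburg ν G (fun u => c * f u) = c * luxemburg ν G f := by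
  obtain ⟨h0, h1⟩ := luxemburg_spec (ν := ν) hG hf hpos
  refine luxemburg_eq_of_integral_eq hG (continuous_const.mul hf)
    (fun u => mul_pos hc (hpos u)) (mul_pos hc h0) ?_
  refine Eq.trans (congrArg (fun F : Sph n → ℝ => ∫ u, F u ∂ν) (funext fun u => ?_)) h1
  change G (c * f u / (c * luxemburg ν G f)) u = _
  rw [mul_div_mul_left _ _ hc.ne']

/-- If `f ≥ r > 0`, an additive error `ε` is at most `(ε / r) f`, so `F i` lies between `(1 - ε / r)
f` and `(1 + ε / r) f`; monotonicity and homogeneity then squeeze the values. -/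
theorem tendsto_luxemburg [NeZero ν] (hG : ClassGI G) {F : ℕ → Sph n → ℝ}
    (hF : ∀ i, Continuous (F i)) (hf : Continuous f) (hpos : ∀ u, 0 < f u)
    {ε : ℕ → ℝ} (hε : Tendsto ε atTop (𝓝 0)) (hFε : ∀ i u, |F i u - f u| ≤ ε i) :
    Tendsto (fun i => luxemburg ν G (F i)) atTop (𝓝 (luxemburg ν G f)) := by
  obtain ⟨r, hr, hrf⟩ := exists_forall_le_of_pos hf hpos
  have hlim : Tendsto (fun i => ε i / r) atTop (𝓝 0) := by simpa using hε.div_const r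
  have hlow : Tendsto (fun i => (1 - ε i / r) * luxemburg ν G f) atTop
      (𝓝 (luxemburg ν G f)) := by
    simpa using (hlim.const_sub 1).mul_const (luxemburg ν G f)
  have hupp : Tendsto (fun i => (1 + ε i / r) * luxemburg ν G f) atTop
      (𝓝 (luxemburg ν G f)) := by
    simpa using (hlim.const_add 1).mul_const (luxemburg ν G f)
  have hscale : ∀ i u, ε i ≤ ε i / r * f u := fun i u => by
    have h0 : 0 ≤ ε i := (abs_nonneg _).trans (hFε i u)
    have := mul_le_mul_of_nonneg_left (hrf u) (div_nonneg h0 hr.le)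
    rwa [div_mul_cancel₀ _ hr.ne'] at this
  have hlt : ∀ᶠ i in atTop, 0 < 1 - ε i / r := by
    filter_upwards [hlim.eventually_lt_const one_pos] with i hi using sub_pos.2 hi
  have hle1 : ∀ i u, (1 - ε i / r) * f u ≤ F i u := fun i u => by
    nlinarith [(abs_le.1 (hFε i u)).1, hscale i u]
  have hle2 : ∀ i u, F i u ≤ (1 + ε i / r) * f u := fun i u => by
    nlinarith [(abs_le.1 (hFε i u)).2, hscale i u]
  refine tendsto_of_tendsto_of_tendsto_of_le_of_le' hlow hupp ?_ ?_
  · filter_upwards [hlt] with i hi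
    rw [← luxemburg_const_mul hG hf hpos hi]
    exact luxemburg_mono hG (continuous_const.mul hf) (fun u => mul_pos hi (hpos u)) (hF i)
      (hle1 i)
  · filter_upwards [hlt] with i hi
    have hFpos : ∀ u, 0 < F i u := fun u => (mul_pos hi (hpos u)).trans_le (hle1 i u)
    have hc : 0 < 1 + ε i / r := by
      obtain ⟨u⟩ : Nonempty (Sph n) := by
        by_contra hne
        rw [not_nonempty_iff] at hne
        exact NeZero.ne ν (Measure.eq_zero_of_isEmpty ν)
      have h0 : 0 ≤ ε i := (abs_nonneg _).trans (hFε i u)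
      positivity
    rw [← luxemburg_const_mul hG hf hpos hc]
    exact luxemburg_mono hG (hF i) hFpos (continuous_const.mul hf) (hle2 i)

end

/-! ### The spherical measure: caps and a divergent integral. -/

open scoped Pointwise ENNReal

noncomputable instance : IsFiniteMeasure (sphMeasure n) := by
  unfold sphMeasure; infer_instance

instance : (sphMeasure n).IsOpenPosMeasure := by
  unfold sphMeasure; infer_instance

theorem sphMeasure_ne_zero [Nonempty (Sph n)] : sphMeasure n ≠ 0 := by
  intro h
  have := isOpen_univ.measure_ne_zero (sphMeasure n) univ_nonempty
  simp [h] at this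

/-- For `y` in the ball, both `‖y - t v‖` and `|‖y‖ - t|` are below `r / 8`, so `‖y - ‖y‖ v‖ < r /
4`. As `‖y‖ > 3 / 8`, dividing by `‖y‖` leaves less than `r`. -/
theorem ball_subset_cone (v : Sph n) {r t : ℝ} (hr : 0 < r) (hr1 : r ≤ 1) (ht : 1 / 2 ≤ t)
    (ht' : t ≤ 3 / 4) :
    Metric.ball (t • (v : Space n)) (r / 8) ⊆
      Ioo (0 : ℝ) 1 • ((↑) '' (Metric.ball v r : Set (Sph n)) : Set (Space n)) := by
  intro y hy
  have hv : ‖(v : Space n)‖ = 1 := by simp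
  have htn : ‖t • (v : Space n)‖ = t := by
    rw [norm_smul, hv, Real.norm_of_nonneg (by linarith), mul_one]
  rw [mem_ball_iff_norm] at hy
  have h1 : |‖y‖ - t| ≤ ‖y - t • (v : Space n)‖ := by
    have := abs_norm_sub_norm_le y (t • (v : Space n))
    rwa [htn] at this
  have h2 := abs_le.1 (h1.trans hy.le)
  have hy0 : 0 < ‖y‖ := by linarith
  have hyu : ‖‖y‖⁻¹ • y‖ = 1 := by rw [norm_smul, norm_inv, norm_norm, inv_mul_cancel₀ hy0.ne']
  refine ⟨‖y‖, ⟨hy0, by linarith⟩, ‖y‖⁻¹ • y, ⟨⟨‖y‖⁻¹ • y, by simpa using hyu⟩, ?_, rfl⟩,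
    by simp [smul_smul, hy0.ne']⟩
  rw [Metric.mem_ball, Subtype.dist_eq, dist_eq_norm]
  have hscale : ‖y‖ * ‖‖y‖⁻¹ • y - (v : Space n)‖ = ‖y - ‖y‖ • (v : Space n)‖ := by
    rw [← norm_norm y, ← norm_smul, norm_norm, smul_sub, smul_smul, mul_inv_cancel₀ hy0.ne',
      one_smul]
  have h3 : ‖y - ‖y‖ • (v : Space n)‖ ≤ ‖y - t • (v : Space n)‖ + |‖y‖ - t| := by
    have : y - ‖y‖ • (v : Space n) = (y - t • (v : Space n)) - (‖y‖ - t) • (v : Space n) := by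
      rw [sub_smul]; abel
    rw [this]
    refine (norm_sub_le _ _).trans ?_
    rw [norm_smul, hv, mul_one, Real.norm_eq_abs]
  have h4 : ‖y‖ * ‖‖y‖⁻¹ • y - (v : Space n)‖ < ‖y‖ * r := by
    rw [hscale]
    nlinarith
  exact lt_of_mul_lt_mul_left h4 hy0.le

/-- A spherical cap of radius `r` has measure at least a multiple of `r ^ (n - 1)`. -/
theorem exists_mul_pow_le_sphMeasure_ball (m : ℕ) : ∃ a : ℝ, 0 < a ∧
    ∀ (v : Sph (m + 1)) (r : ℝ), 0 < r → r ≤ 1 →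
      ENNReal.ofReal (a * r ^ m) ≤ sphMeasure (m + 1) (Metric.ball v r) := by
  set b := (volume : Measure (Space (m + 1))).real (Metric.ball 0 1) with hb
  have hb0 : 0 < b := ENNReal.toReal_pos (Metric.measure_ball_pos _ _ one_pos).ne' measure_ball_lt_top.ne
  refine ⟨b / (2 * 8 ^ (m + 1)), by positivity, fun v r hr hr1 => ?_⟩
  have hv : ‖(v : Space (m + 1))‖ = 1 := by simp
  -- About `1 / r` disjoint balls of radius `r / 8` are stacked along the ray of `v` between heights
  -- `1 / 2` and `3 / 4`. Each has volume of order `r ^ (m + 1)`, so the cone has volume at least of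
  -- order `r ^ m`.
  set N := ⌊1 / r⌋₊ with hN
  have hNle : (N : ℝ) ≤ 1 / r := Nat.floor_le (by positivity)
  have hN1 : (1 : ℝ) ≤ N := by
    exact_mod_cast Nat.le_floor (by rw [Nat.cast_one, le_div_iff₀ hr]; linarith)
  have hNge : 1 / (2 * r) ≤ N := by
    have h1 : 1 / r < N + 1 := Nat.lt_floor_add_one _
    have h2 : 1 / (2 * r) = (1 / r) / 2 := by field_simp
    linarith
  let c : ℕ → Space (m + 1) := fun k => (1 / 2 + k * (r / 4)) • (v : Space (m + 1))
  have hsub : (⋃ k ∈ Finset.range N, Metric.ball (c k) (r / 8)) ⊆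
      Ioo (0 : ℝ) 1 • ((↑) '' (Metric.ball v r : Set (Sph (m + 1))) : Set (Space (m + 1))) := by
    refine iUnion₂_subset fun k hk => ball_subset_cone v hr hr1 ?_ ?_
    · have : 0 ≤ (k : ℝ) * (r / 4) := by positivity
      linarith
    · have h1 : (k : ℝ) ≤ N := by exact_mod_cast (Finset.mem_range.1 hk).le
      have h2 : (k : ℝ) * r ≤ 1 := by
        rw [← le_div_iff₀ hr]; exact h1.trans hNle
      linarith
  have hdisj : Set.PairwiseDisjoint (↑(Finset.range N)) fun k => Metric.ball (c k) (r / 8) := by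
    intro i _ j _ hij
    refine Metric.ball_disjoint_ball ?_
    have h1 : dist (c i) (c j) = |(i : ℝ) - j| * (r / 4) := by
      rw [dist_eq_norm, ← sub_smul, norm_smul, hv, mul_one, Real.norm_eq_abs,
        show (1 / 2 + (i : ℝ) * (r / 4)) - (1 / 2 + (j : ℝ) * (r / 4)) = (i - j) * (r / 4) by ring,
        abs_mul, abs_of_pos (by positivity : 0 < r / 4)]
    have h2 : (1 : ℝ) ≤ |(i : ℝ) - j| := by
      have : (1 : ℤ) ≤ |(i : ℤ) - j| := Int.one_le_abs (sub_ne_zero.2 (by exact_mod_cast hij))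
      exact_mod_cast this
    rw [h1]
    nlinarith
  have hvol : ∀ k, volume (Metric.ball (c k) (r / 8)) = ENNReal.ofReal ((r / 8) ^ (m + 1) * b) := by
    intro k
    rw [Measure.addHaar_ball_of_pos _ _ (by positivity : 0 < r / 8), finrank_euclideanSpace_fin,
      hb, measureReal_def, ENNReal.ofReal_mul (by positivity),
      ENNReal.ofReal_toReal measure_ball_lt_top.ne]
  have hmeas : volume (⋃ k ∈ Finset.range N, Metric.ball (c k) (r / 8)) =
      ENNReal.ofReal (N * ((r / 8) ^ (m + 1) * b)) := by
    rw [measure_biUnion_finset hdisj fun _ _ => Metric.isOpen_ball.measurableSet]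
    simp only [hvol, Finset.sum_const, Finset.card_range, nsmul_eq_mul]
    rw [ENNReal.ofReal_mul (Nat.cast_nonneg N), ENNReal.ofReal_natCast]
  rw [sphMeasure, Measure.toSphere_apply' _ Metric.isOpen_ball.measurableSet,
    finrank_euclideanSpace_fin]
  calc ENNReal.ofReal (b / (2 * 8 ^ (m + 1)) * r ^ m)
      ≤ ENNReal.ofReal (N * ((r / 8) ^ (m + 1) * b)) := by
        refine ENNReal.ofReal_le_ofReal ?_
        have : b / (2 * 8 ^ (m + 1)) * r ^ m = 1 / (2 * r) * ((r / 8) ^ (m + 1) * b) := by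
          rw [div_pow, pow_succ r]; field_simp
        rw [this]
        exact mul_le_mul_of_nonneg_right hNge (by positivity)
    _ = volume (⋃ k ∈ Finset.range N, Metric.ball (c k) (r / 8)) := hmeas.symm
    _ ≤ _ := measure_mono hsub
    _ ≤ _ := le_mul_of_one_le_left zero_le (by exact_mod_cast Nat.le_add_left 1 m)

theorem sphMeasure_singleton (m : ℕ) (v : Sph (m + 2)) : sphMeasure (m + 2) {v} = 0 := by
  rw [sphMeasure, Measure.toSphere_apply' _ (measurableSet_singleton v), mul_eq_zero]
  right
  refine measure_mono_null (t := (ℝ ∙ (v : Space (m + 2)) : Submodule ℝ _)) ?_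
    (Measure.addHaar_submodule _ _ ?_)
  · rintro _ ⟨t, -, _, ⟨w, rfl, rfl⟩, rfl⟩
    exact Submodule.smul_mem _ _ (Submodule.mem_span_singleton_self _)
  · intro h
    have h1 := finrank_span_le_card (R := ℝ) ({(v : Space (m + 2))} : Set (Space (m + 2)))
    rw [h, finrank_top, finrank_euclideanSpace_fin] at h1
    simp at h1

/-- For `m = 0` the cap bound does not depend on the radius, so it survives shrinking the cap to its
centre. -/
theorem sphMeasure_one_singleton_ne_zero (v : Sph 1) : sphMeasure 1 {v} ≠ 0 := by
  obtain ⟨a, ha, h⟩ := exists_mul_pow_le_sphMeasure_ball 0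
  have h1 : (({v} : Set (Sph 1))) = ⋂ k : ℕ, Metric.ball v (1 / ((k : ℝ) + 1)) := by
    ext w
    simp only [mem_singleton_iff, mem_iInter, Metric.mem_ball]
    refine ⟨fun h k => by rw [h, dist_self]; positivity, fun h => ?_⟩
    refine dist_le_zero.1 (le_of_forall_pos_lt_add fun ε hε => ?_)
    obtain ⟨k, hk⟩ := exists_nat_one_div_lt hε
    linarith [h k]
  have h2 : ENNReal.ofReal a ≤ sphMeasure 1 {v} := by
    rw [h1, Antitone.measure_iInter]
    · refine le_iInf fun k => ?_
      have := h v (1 / ((k : ℝ) + 1)) (by positivity)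
        (div_le_one_of_le₀ (by linarith [(Nat.cast_nonneg k : (0 : ℝ) ≤ k)]) (by positivity))
      simpa using this
    · intro i j hij
      exact Metric.ball_subset_ball (by gcongr)
    · exact fun _ => Metric.isOpen_ball.measurableSet.nullMeasurableSet
    · exact ⟨0, measure_ne_top _ _⟩
  intro h0
  rw [h0] at h2
  exact absurd (ENNReal.ofReal_eq_zero.1 (le_zero_iff.1 h2)) (not_le.2 ha)

theorem lintegral_Ioi_const_div_eq_top {a t₀ : ℝ} (ha : 0 < a) (ht₀ : 0 < t₀) :
    ∫⁻ t in Ioi t₀, ENNReal.ofReal (a * t⁻¹) = ⊤ := by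
  by_contra hne
  refine not_integrableOn_Ioi_inv (a := t₀) ?_
  have hm : AEStronglyMeasurable (fun t : ℝ => a * t⁻¹) (volume.restrict (Ioi t₀)) :=
    (measurable_inv.const_mul a).aestronglyMeasurable
  have hi : IntegrableOn (fun t : ℝ => a * t⁻¹) (Ioi t₀) := by
    refine ⟨hm, ?_⟩
    rw [hasFiniteIntegral_iff_ofReal]
    · exact lt_top_iff_ne_top.2 hne
    · filter_upwards [ae_restrict_mem measurableSet_Ioi] with t ht
      have : 0 < t := ht₀.trans ht
      positivity
  have := hi.const_mul a⁻¹
  refine this.congr (Eventually.of_forall fun t => ?_)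
  simp [← mul_assoc, inv_mul_cancel₀ ha.ne']

/-- The function `d(u, v) ^ (-(n - 1))` is not integrable near the point `v` of the sphere. -/
theorem lintegral_inv_dist_pow_eq_top (m : ℕ) (v : Sph (m + 2)) {c δ : ℝ} (hc : 0 < c)
    (hδ : 0 < δ) :
    ∫⁻ u in Metric.ball v δ, ENNReal.ofReal (c * ((dist u v)⁻¹) ^ (m + 1))
      ∂(sphMeasure (m + 2)) = ⊤ := by
  obtain ⟨a, ha, hcap⟩ := exists_mul_pow_le_sphMeasure_ball (m + 1)
  set σ := sphMeasure (m + 2) with hσ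
  set f : Sph (m + 2) → ℝ := fun u => c * ((dist u v)⁻¹) ^ (m + 1) with hf
  have hmeas : Measurable f := by fun_prop
  have hnn : 0 ≤ᵐ[σ.restrict (Metric.ball v δ)] f :=
    Eventually.of_forall fun u => by simp only [hf, Pi.zero_apply]; positivity
  -- Layer cake: the superlevel set at height `t` contains a punctured cap of radius `r` with `r ^
  -- (m + 1) = c / t`, of measure at least `a c / t`, and `∫ dt / t` diverges at infinity. Heights
  -- above `c / ε ^ (m + 1)` keep `r ≤ ε`.
  rw [lintegral_eq_lintegral_meas_lt _ hnn hmeas.aemeasurable, eq_top_iff]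
  set ε := min δ 1 with hε
  have hε0 : 0 < ε := lt_min hδ one_pos
  have ht₀ : 0 < c / ε ^ (m + 1) := by positivity
  have hsub : Ioi (c / ε ^ (m + 1)) ⊆ Ioi (0 : ℝ) := Ioi_subset_Ioi ht₀.le
  rw [← lintegral_Ioi_const_div_eq_top (mul_pos ha hc) ht₀]
  refine le_trans (setLIntegral_mono' measurableSet_Ioi fun t ht => ?_)
    (lintegral_mono_set hsub)
  have ht0 : 0 < t := ht₀.trans ht
  set r : ℝ := (c / t) ^ ((1 : ℝ) / ((m + 1 : ℕ) : ℝ)) with hr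
  have hct : 0 < c / t := by positivity
  have hr0 : 0 < r := Real.rpow_pos_of_pos hct _
  have hrpow : r ^ (m + 1) = c / t := by
    rw [hr, one_div, Real.rpow_inv_natCast_pow hct.le (Nat.succ_ne_zero m)]
  have hrε : r ≤ ε := by
    refine le_of_pow_le_pow_left₀ (Nat.succ_ne_zero m) hε0.le ?_
    rw [hrpow, div_le_iff₀ ht0, mul_comm, ← div_le_iff₀ (by positivity)]
    exact le_of_lt ht
  have h1 := hcap v r hr0 (hrε.trans (min_le_right _ _))
  rw [hrpow] at h1
  -- The centre must go: there `(dist u v)⁻¹` is `0⁻¹ = 0`, so `f v = 0`.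
  have h2 : σ (Metric.ball v r) = σ (Metric.ball v r \ {v}) :=
    (measure_sdiff_null (sphMeasure_singleton m v)).symm
  have h3 : Metric.ball v r \ {v} ⊆ {u | t < f u} := by
    rintro u ⟨hu, huv⟩
    have hd0 : 0 < dist u v := dist_pos.2 huv
    have hd : dist u v ^ (m + 1) < c / t := by
      rw [← hrpow]
      exact pow_lt_pow_left₀ hu hd0.le (Nat.succ_ne_zero m)
    simp only [hf, mem_ofPred_eq, inv_pow, ← div_eq_mul_inv]
    rwa [lt_div_iff₀ (by positivity), ← lt_div_iff₀' ht0]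
  rw [Measure.restrict_apply (measurableSet_lt measurable_const hmeas)]
  calc ENNReal.ofReal (a * c * t⁻¹) = ENNReal.ofReal (a * (c / t)) := by
        rw [mul_assoc, div_eq_mul_inv]
    _ ≤ σ (Metric.ball v r \ {v}) := h1.trans_eq h2
    _ ≤ _ := measure_mono (subset_inter h3 (sdiff_subset.trans
        (Metric.ball_subset_ball (hrε.trans (min_le_left _ _)))))


/-! ### Limits of convex bodies, and why they keep the origin in the interior. -/

/-- **Blaschke's selection theorem.** -/
theorem exists_subseq_tendsto_convexBody {Q : ℕ → ConvexBody (Space n)} {R : ℝ}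
    (hQ : ∀ i, (Q i : Set (Space n)) ⊆ Metric.closedBall 0 R) :
    ∃ (M : ConvexBody (Space n)) (ψ : ℕ → ℕ), StrictMono ψ ∧
      Tendsto (fun i => dist (Q (ψ i)) M) atTop (𝓝 0) := by
  let L : ℕ → TopologicalSpace.NonemptyCompacts (Space n) := fun i =>
    ⟨⟨Q i, (Q i).isCompact⟩, (Q i).nonempty⟩
  obtain ⟨M, -, ψ, hψ, hlim⟩ :=
    (TopologicalSpace.NonemptyCompacts.isCompact_subsets_of_isCompact
      (isCompact_closedBall (0 : Space n) R)).tendsto_subseq (x := L) hQ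
  have hdist : Tendsto (fun i => Metric.hausdorffDist (Q (ψ i) : Set (Space n)) M) atTop (𝓝 0) :=
    tendsto_iff_dist_tendsto_zero.1 hlim
  have hfin : ∀ i, Metric.hausdorffEDist (Q i : Set (Space n)) M ≠ ⊤ := fun i =>
    Metric.hausdorffEDist_ne_top_of_nonempty_of_bounded (Q i).nonempty M.nonempty (Q i).isBounded
      M.isCompact.isBounded
  -- Compactness of the space of nonempty compact subsets of the ball gives the limit; only its
  -- convexity is left. Points of `M` are moved into `Q (ψ i)`, combined there and moved back, at a
  -- cost of `ε / 2` each way.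
  have hconv : Convex ℝ (M : Set (Space n)) := by
    intro a ha b hb s t hs ht hst
    rw [← M.isCompact.isClosed.closure_eq, Metric.mem_closure_iff]
    intro ε hε
    obtain ⟨i, hi⟩ := (hdist.eventually_lt_const (half_pos hε)).exists
    obtain ⟨a', ha', haa⟩ := Metric.exists_dist_lt_of_hausdorffDist_lt' ha hi (hfin _)
    obtain ⟨b', hb', hbb⟩ := Metric.exists_dist_lt_of_hausdorffDist_lt' hb hi (hfin _)
    obtain ⟨z, hz, hzz⟩ := Metric.exists_dist_lt_of_hausdorffDist_lt
      ((Q (ψ i)).convex ha' hb' hs ht hst) hi (hfin _)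
    refine ⟨z, hz, ?_⟩
    have h1 : dist (s • a + t • b) (s • a' + t • b') ≤ ε / 2 := by
      refine (dist_add_add_le _ _ _ _).trans ?_
      rw [dist_smul₀, dist_smul₀, Real.norm_of_nonneg hs, Real.norm_of_nonneg ht, dist_comm a,
        dist_comm b]
      nlinarith
    linarith [dist_triangle (s • a + t • b) (s • a' + t • b') z]
  exact ⟨⟨M, hconv, M.isCompact, M.nonempty⟩, ψ, hψ, hdist⟩

theorem zero_mem_of_tendsto {Q : ℕ → ConvexBody (Space n)} {M : ConvexBody (Space n)}
    (hlim : Tendsto (fun i => dist (Q i) M) atTop (𝓝 0)) (h0 : ∀ i, (0 : Space n) ∈ Q i) :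
    (0 : Space n) ∈ M := by
  rw [← SetLike.mem_coe, ← M.isClosed.closure_eq, Metric.mem_closure_iff]
  intro ε hε
  obtain ⟨i, hi⟩ := (hlim.eventually_lt_const hε).exists
  exact Metric.exists_dist_lt_of_hausdorffDist_lt (h0 i) hi ConvexBody.hausdorffEDist_ne_top

theorem tendsto_supportFn {Q : ℕ → ConvexBody (Space n)} {M : ConvexBody (Space n)}
    (hlim : Tendsto (fun i => dist (Q i) M) atTop (𝓝 0)) (u : Sph n) :
    Tendsto (fun i => supportFn (Q i : Set (Space n)) u) atTop
      (𝓝 (supportFn (M : Set (Space n)) u)) := by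
  rw [tendsto_iff_dist_tendsto_zero]
  exact squeeze_zero (fun _ => dist_nonneg) (fun i => abs_supportFn_sub_le_dist (Q i) M u) hlim

/-- `G(t, u) ≥ c t ^ (n - 1)` for all large `t`, with a positive constant `c`. -/
def PowGrowth (G : ℝ → Sph n → ℝ) : Prop :=
  ∃ c T : ℝ, 0 < c ∧ 0 < T ∧ ∀ t u, T ≤ t → c * t ^ (n - 1) ≤ G t u

theorem GrowthCondition.powGrowth {G : ℝ → Sph n → ℝ} (hG : ClassGI G) {q : ℝ} (hn : n ≠ 0)
    (hq : (n : ℝ) - 1 ≤ q) (h : GrowthCondition G q) : PowGrowth G := by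
  refine ⟨_, 1, h, one_pos, fun t u ht => ?_⟩
  have ht0 : 0 < t := by linarith
  have hb : BddBelow {x : ℝ | ∃ (t : ℝ) (u : Sph n), 1 ≤ t ∧ x = G t u / t ^ q} := by
    refine ⟨0, ?_⟩
    rintro _ ⟨s, w, hs, rfl⟩
    have hs0 : 0 < s := by linarith
    exact div_nonneg (hG.pos s w hs0).le (Real.rpow_nonneg hs0.le q)
  have h1 := csInf_le hb ⟨t, u, ht, rfl⟩
  rw [le_div_iff₀ (Real.rpow_pos_of_pos ht0 q)] at h1
  refine le_trans (mul_le_mul_of_nonneg_left ?_ h.le) h1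
  rw [← Real.rpow_natCast]
  refine Real.rpow_le_rpow_of_exponent_le ht ?_
  rwa [Nat.cast_sub (Nat.one_le_iff_ne_zero.2 hn), Nat.cast_one]

theorem PowGrowth.comp_div {G : ℝ → Sph n → ℝ} (h : PowGrowth G) {s : ℝ} (hs : 0 < s) :
    PowGrowth fun t u => G (t / s) u := by
  obtain ⟨c, T, hc, hT, h⟩ := h
  refine ⟨c / s ^ (n - 1), T * s, by positivity, by positivity, fun t u ht => ?_⟩
  have := h (t / s) u (by rwa [le_div_iff₀ hs])
  rwa [div_pow, mul_div_assoc', ← div_mul_eq_mul_div] at this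

/-- If the dual volumes of the polars of the bodies `Q i` are all equal to `c`, the limit of the
`Q i` has the origin in its interior. -/
theorem supportFn_pos_of_tendsto {G : ℝ → Sph n → ℝ} (hG : ClassGI G) (hgr : PowGrowth G)
    {Q : ℕ → ConvexBody (Space n)} {M : ConvexBody (Space n)} {c : ℝ}
    (hQ : ∀ i, Q i ∈ bodiesO n)
    (hc : ∀ i, ∫ u, G (supportFn (Q i : Set (Space n)) u)⁻¹ u ∂(sphMeasure n) = c)
    (hlim : Tendsto (fun i => dist (Q i) M) atTop (𝓝 0)) (v : Sph n) :
    0 < supportFn (M : Set (Space n)) v := by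
  have h0M : (0 : Space n) ∈ M := zero_mem_of_tendsto hlim fun i => interior_subset (hQ i)
  by_contra hv
  have hv0 : supportFn (M : Set (Space n)) v = 0 :=
    le_antisymm (not_lt.1 hv) (supportFn_nonneg h0M v)
  have hpos : ∀ i u, 0 < (supportFn (Q i : Set (Space n)) u)⁻¹ := fun i u =>
    inv_pos.2 (supportFn_pos (hQ i) u)
  have hcinv : ∀ i, Continuous fun u => (supportFn (Q i : Set (Space n)) u)⁻¹ := fun i =>
    (continuous_supportFn (Q i)).inv₀ fun u => (supportFn_pos (hQ i) u).ne'
  have hcont : ∀ i, Continuous fun u => G (supportFn (Q i : Set (Space n)) u)⁻¹ u := fun i =>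
    hG.continuous_comp (hcinv i) (hpos i)
  let F : ℕ → Sph n → ENNReal := fun i u =>
    ENNReal.ofReal (G (supportFn (Q i : Set (Space n)) u)⁻¹ u)
  have hFint : ∀ i, ∫⁻ u, F i u ∂(sphMeasure n) = ENNReal.ofReal c := fun i => by
    rw [← hc i, ofReal_integral_eq_lintegral_ofReal (hG.integrable_comp (hcinv i) (hpos i))
      (Eventually.of_forall fun u => (hG.pos _ u (hpos i u)).le)]
  -- By Fatou it suffices to show that a zero of `h_M` makes the integral of the liminf infinite.
  have hfatou : ∫⁻ u, liminf (fun i => F i u) atTop ∂(sphMeasure n) ≤ ENNReal.ofReal c := by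
    refine (lintegral_liminf_le fun i =>
      ENNReal.measurable_ofReal.comp (hcont i).measurable).trans_eq ?_
    exact (congrArg (fun g : ℕ → ENNReal => liminf g atTop) (funext hFint)).trans (liminf_const _)
  refine absurd hfatou (not_le.2 ?_)
  suffices h : ∫⁻ u, liminf (fun i => F i u) atTop ∂(sphMeasure n) = ⊤ by
    rw [h]; exact ENNReal.ofReal_lt_top
  rw [eq_top_iff]
  have htend := tendsto_supportFn hlim
  obtain _ | _ | m := n
  · exact absurd v.2 (by simp [Subsingleton.elim (v : Space 0) 0])
  -- On `S^0` the point `v` is an atom, so divergence of the integrand at `v` alone is enough.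
  · have hinv : Tendsto (fun i => (supportFn (Q i : Set (Space 1)) v)⁻¹) atTop atTop := by
      refine Tendsto.inv_tendsto_nhdsGT_zero (tendsto_nhdsWithin_iff.2 ⟨?_, ?_⟩)
      · rw [← hv0]; exact htend v
      · exact Eventually.of_forall fun i => supportFn_pos (hQ i) v
    have hF : Tendsto (fun i => F i v) atTop (𝓝 ⊤) :=
      ENNReal.tendsto_ofReal_atTop.comp ((hG.tendsto_atTop v).comp hinv)
    calc (⊤ : ENNReal) = ⊤ * sphMeasure 1 {v} :=
          (ENNReal.top_mul (sphMeasure_one_singleton_ne_zero v)).symm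
      _ = ∫⁻ u in {v}, liminf (fun i => F i u) atTop ∂(sphMeasure 1) := by
          rw [lintegral_singleton, hF.liminf_eq]
      _ ≤ _ := setLIntegral_le_lintegral _ _
  · obtain ⟨R, hR, hMR⟩ := exists_subset_closedBall M
    obtain ⟨b, T, hb, hT, hgrow⟩ := hgr
    -- Within this radius of `v`, `1 / (2 R d(u, v)) ≥ T`, the range where the growth bound applies.
    -- The Lipschitz constant `R` is doubled to get a strict inequality for `h_M(u)`, which `Q i`
    -- inherits eventually.
    have hδ : 0 < (2 * R * T)⁻¹ := by positivity
    have hb' : 0 < b * (2 * R)⁻¹ ^ (m + 1) := by positivity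
    rw [← lintegral_inv_dist_pow_eq_top m v hb' hδ]
    refine le_trans (setLIntegral_mono' Metric.isOpen_ball.measurableSet fun u hu => ?_)
      (setLIntegral_le_lintegral (Metric.ball v (2 * R * T)⁻¹) _)
    rcases eq_or_ne u v with rfl | huv
    -- At the centre the lower bound is `0`, again because `0⁻¹ = 0`.
    · simp
    · have hd : 0 < dist u v := dist_pos.2 huv
      have hMu : supportFn (M : Set (Space (m + 2))) u < 2 * R * dist u v := by
        have h1 := supportFn_le_add_mul_dist hMR u v
        have h2 : 0 < R * dist u v := by positivity
        rw [hv0] at h1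
        linarith
      refine le_liminf_of_le (by isBoundedDefault) ?_
      filter_upwards [(htend u).eventually_lt_const hMu] with i hi
      refine ENNReal.ofReal_le_ofReal ?_
      have h1 : (2 * R * dist u v)⁻¹ ≤ (supportFn (Q i : Set (Space (m + 2))) u)⁻¹ :=
        inv_anti₀ (supportFn_pos (hQ i) u) hi.le
      have h2 : T ≤ (2 * R * dist u v)⁻¹ := by
        rw [le_inv_comm₀ hT (by positivity)]
        have h3 : dist u v ≤ (2 * R * T)⁻¹ := le_of_lt hu
        calc 2 * R * dist u v ≤ 2 * R * (2 * R * T)⁻¹ := by gcongr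
          _ = T⁻¹ := by field_simp
      refine le_trans ?_ (hgrow _ u (h2.trans h1))
      rw [mul_assoc, ← mul_pow, ← mul_inv]
      exact mul_le_mul_of_nonneg_left (pow_le_pow_left₀ (by positivity) h1 _) hb.le

/-! ### A bound on the bodies from a bound on the norm. -/

/-- The integral of the positive part of `⟪u, v⟫` is continuous and positive in `v`, hence at least
some `m > 0` on the compact sphere. The part of the sphere where `⟪u, v⟫ < δ` contributes at most `δ
μ(univ) ≤ m / 2`, and elsewhere the integrand is at most `1`. -/
theorem exists_uniform_hemisphere_mass {μ : Measure (Sph n)} [IsFiniteMeasure μ]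
    (hμ : NotConcentratedOnHemisphere μ) :
    ∃ δ m : ℝ, 0 < δ ∧ 0 < m ∧ ∀ v : Sph n, m ≤ μ.real {u | δ ≤ ⟪(u : Space n), (v : Space n)⟫} := by
  have hcont : Continuous fun v : Sph n =>
      ∫ u : Sph n, max ⟪(u : Space n), (v : Space n)⟫ 0 ∂μ := by
    refine continuous_of_dominated (bound := fun _ => 1) ?_ ?_ (integrable_const _) ?_
    · exact fun v => (by fun_prop : Continuous fun u : Sph n =>
        max ⟪(u : Space n), (v : Space n)⟫ 0).aestronglyMeasurable
    · refine fun v => Eventually.of_forall fun u => ?_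
      have h1 := real_inner_le_norm (u : Space n) (v : Space n)
      have h2 : ‖(u : Space n)‖ * ‖(v : Space n)‖ = 1 := by simp
      rw [h2] at h1
      rw [Real.norm_of_nonneg (le_max_right _ _)]
      exact max_le h1 zero_le_one
    · exact Eventually.of_forall fun u => by fun_prop
  have hint : ∀ v : Sph n, Integrable (fun u : Sph n => max ⟪(u : Space n), (v : Space n)⟫ 0) μ :=
    fun v => integrable_of_continuous (by fun_prop)
  have hpos : ∀ v : Sph n, 0 < ∫ u : Sph n, max ⟪(u : Space n), (v : Space n)⟫ 0 ∂μ := by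
    intro v
    refine (integral_pos_iff_support_of_nonneg (fun u => le_max_right _ _) (hint v)).2 ?_
    refine lt_of_lt_of_le (pos_iff_ne_zero.2 (hμ (-v))) (measure_mono fun u hu => ?_)
    have h1 : 0 < ⟪(u : Space n), (v : Space n)⟫ := by
      simpa [inner_neg_right] using hu
    simpa [Function.mem_support] using h1
  obtain ⟨m, hm, hle⟩ := exists_forall_le_of_pos hcont hpos
  set δ := m / (2 * (μ.real univ + 1)) with hδ
  have hμnn : 0 ≤ μ.real univ := measureReal_nonneg
  have hδ0 : 0 < δ := by positivity
  refine ⟨δ, m / 2, hδ0, by positivity, fun v => ?_⟩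
  have hS : MeasurableSet {u : Sph n | δ ≤ ⟪(u : Space n), (v : Space n)⟫} :=
    (isClosed_le continuous_const (by fun_prop)).measurableSet
  have hδμ : δ * μ.real univ ≤ m / 2 := by
    have : δ * (μ.real univ + 1) = m / 2 := by rw [hδ]; field_simp
    nlinarith
  have h1 : ∫ u : Sph n, max ⟪(u : Space n), (v : Space n)⟫ 0 ∂μ ≤
      ∫ u : Sph n, ({u : Sph n | δ ≤ ⟪(u : Space n), (v : Space n)⟫}.indicator 1 u + δ) ∂μ := by
    refine MeasureTheory.integral_mono (hint v)
      (((integrable_const (1 : ℝ)).indicator hS).add (integrable_const δ)) fun u => ?_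
    have h1 := real_inner_le_norm (u : Space n) (v : Space n)
    have h2 : ‖(u : Space n)‖ * ‖(v : Space n)‖ = 1 := by simp
    rw [h2] at h1
    by_cases hu : δ ≤ ⟪(u : Space n), (v : Space n)⟫
    · rw [indicator_of_mem (by exact hu), Pi.one_apply]
      exact max_le (by linarith) (by linarith)
    · rw [indicator_of_notMem (by exact hu), zero_add]
      exact max_le (not_le.1 hu).le hδ0.le
  rw [integral_add (f := {u : Sph n | δ ≤ ⟪(u : Space n), (v : Space n)⟫}.indicator 1)
    ((integrable_const (1 : ℝ)).indicator hS) (integrable_const δ), integral_indicator_one hS,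
    integral_const, smul_eq_mul] at h1
  linarith [hle v]

/-- A far point `x ∈ K` forces `h_K(u) ≥ δ ‖x‖` on a cap around its direction of mass at least `m`.
By Markov's inequality the integral is then at least `m φ(t) > C`. -/
theorem exists_forall_subset_closedBall {φ : ℝ → ℝ} (hφ : ClassI φ) {μ : Measure (Sph n)}
    [IsFiniteMeasure μ] (hμ : NotConcentratedOnHemisphere μ) {Λ : ℝ} (hΛ : 0 < Λ) (C : ℝ) :
    ∃ R, ∀ K ∈ bodiesO n, ∫ u, φ (supportFn (K : Set (Space n)) u / Λ) ∂μ ≤ C →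
      (K : Set (Space n)) ⊆ Metric.closedBall 0 R := by
  obtain ⟨δ, m, hδ, hm, hmass⟩ := exists_uniform_hemisphere_mass hμ
  obtain ⟨t, ht, ht0⟩ := ((hφ.tendsto_atTop.eventually_gt_atTop (C / m)).and
    (eventually_gt_atTop 0)).exists
  rw [div_lt_iff₀ hm] at ht
  refine ⟨t * Λ / δ, fun K hK hKC x hx => ?_⟩
  rw [mem_closedBall_zero_iff]
  by_contra! hlt
  have hx0 : 0 < ‖x‖ := lt_trans (by positivity) hlt
  let v : Sph n := ⟨‖x‖⁻¹ • x, by simp [norm_smul, hx0.ne']⟩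
  have hpos : ∀ u, 0 < supportFn (K : Set (Space n)) u / Λ := fun u =>
    div_pos (supportFn_pos hK u) hΛ
  have hint : Integrable (fun u => φ (supportFn (K : Set (Space n)) u / Λ)) μ :=
    hφ.classGI.integrable_comp ((continuous_supportFn K).div_const Λ) hpos
  have hmarkov := mul_meas_ge_le_integral_of_nonneg
    (Eventually.of_forall fun u => (hφ.pos _ (hpos u)).le) hint (φ t)
  have hsub : {u : Sph n | δ ≤ ⟪(u : Space n), (v : Space n)⟫} ⊆
      {u | φ t ≤ φ (supportFn (K : Set (Space n)) u / Λ)} := by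
    intro u hu
    refine hφ.strictMonoOn.monotoneOn (mem_Ioi.2 ht0) (mem_Ioi.2 (hpos u)) ?_
    have h1 : δ ≤ ‖x‖⁻¹ * ⟪(u : Space n), x⟫ := by
      have : δ ≤ ⟪(u : Space n), ‖x‖⁻¹ • x⟫ := hu
      rwa [real_inner_smul_right] at this
    rw [le_inv_mul_iff₀ hx0, real_inner_comm] at h1
    rw [div_lt_iff₀ hδ] at hlt
    rw [le_div_iff₀ hΛ]
    linarith [inner_le_supportFn K hx u]
  have h2 := mul_le_mul_of_nonneg_left ((hmass v).trans (measureReal_mono hsub))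
    (hφ.pos t ht0).le
  linarith

/-! ### Existence of a minimizer on a level set. -/

theorem orliczNorm_eq_luxemburg (μ : Measure (Sph n)) (φ : ℝ → ℝ) (f : Sph n → ℝ) :
    orliczNorm μ φ f = luxemburg μ (fun t _ => 1 / μ.real univ * φ t) f := by
  simp only [orliczNorm, luxemburg, integral_const_mul]

/-- The bodies `Q` for which the integral of `G(1 / h_Q(u), u)` over the sphere equals `c`. -/
def levelSet (G : ℝ → Sph n → ℝ) (c : ℝ) : Set (ConvexBody (Space n)) :=
  {Q | Q ∈ bodiesO n ∧ ∫ u, G (supportFn (Q : Set (Space n)) u)⁻¹ u ∂(sphMeasure n) = c}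

theorem tendsto_integral_of_tendsto {G : ℝ → Sph n → ℝ} (hG : ClassGI G)
    {Q : ℕ → ConvexBody (Space n)} {M : ConvexBody (Space n)}
    (hQ : ∀ i, Q i ∈ bodiesO n) (hM : M ∈ bodiesO n)
    (hlim : Tendsto (fun i => dist (Q i) M) atTop (𝓝 0)) :
    Tendsto (fun i => ∫ u, G (supportFn (Q i : Set (Space n)) u)⁻¹ u ∂(sphMeasure n)) atTop
      (𝓝 (∫ u, G (supportFn (M : Set (Space n)) u)⁻¹ u ∂(sphMeasure n))) := by
  obtain ⟨r, hr, hle⟩ := exists_forall_le_of_pos (continuous_supportFn M) (supportFn_pos hM)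
  have hcinv : ∀ K ∈ bodiesO n, Continuous fun u => (supportFn (K : Set (Space n)) u)⁻¹ :=
    fun K hK => (continuous_supportFn K).inv₀ fun u => (supportFn_pos hK u).ne'
  have hr2 : 0 < (r / 2)⁻¹ := by positivity
  refine tendsto_integral_filter_of_dominated_convergence (fun u => G (r / 2)⁻¹ u) ?_ ?_ ?_ ?_
  · exact Eventually.of_forall fun i => (hG.integrable_comp (hcinv _ (hQ i))
      fun u => inv_pos.2 (supportFn_pos (hQ i) u)).aestronglyMeasurable
  · filter_upwards [hlim.eventually_lt_const (half_pos hr)] with i hi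
    refine Eventually.of_forall fun u => ?_
    have h0 := inv_pos.2 (supportFn_pos (hQ i) u)
    rw [Real.norm_of_nonneg (hG.pos _ u h0).le]
    refine hG.mono h0 (inv_anti₀ (half_pos hr) ?_) u
    linarith [(abs_le.1 (abs_supportFn_sub_le_dist (Q i) M u)).1, hle u]
  · exact hG.integrable_comp (f := fun _ => (r / 2)⁻¹) continuous_const fun _ => hr2
  · refine Eventually.of_forall fun u => ?_
    have hMu := supportFn_pos hM u
    have hc : ContinuousAt (fun p : ℝ × Sph n => G p.1 p.2)
        ((supportFn (M : Set (Space n)) u)⁻¹, u) :=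
      hG.continuousOn.continuousAt
        ((isOpen_Ioi.prod isOpen_univ).mem_nhds ⟨inv_pos.2 hMu, mem_univ u⟩)
    exact hc.tendsto.comp (((tendsto_supportFn hlim u).inv₀ hMu.ne').prodMk_nhds
      tendsto_const_nhds)

theorem bddBelow_orliczNorm_image (μ : Measure (Sph n)) (φ : ℝ → ℝ)
    (B : Set (ConvexBody (Space n))) :
    BddBelow ((fun Q : ConvexBody (Space n) =>
      orliczNorm μ φ (supportFn (Q : Set (Space n)))) '' B) := by
  refine ⟨0, ?_⟩
  rintro _ ⟨Q, -, rfl⟩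
  exact Real.sInf_nonneg fun s hs => hs.1.le

theorem classGI_normalized {φ : ℝ → ℝ} (hφ : ClassI φ) (μ : Measure (Sph n)) [IsFiniteMeasure μ]
    [NeZero μ] : ClassGI fun t (_ : Sph n) => 1 / μ.real univ * φ t :=
  hφ.classGI.const_mul (one_div_pos.2 measureReal_univ_pos)

theorem exists_isSolution_levelSet {φ : ℝ → ℝ} (hφ : ClassI φ) {μ : Measure (Sph n)}
    [IsFiniteMeasure μ] [NeZero μ] (hμ : NotConcentratedOnHemisphere μ) {G : ℝ → Sph n → ℝ}
    (hG : ClassGI G) (hgr : PowGrowth G) {c : ℝ} (hne : (levelSet G c).Nonempty) :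
    ∃ M, IsSolution μ φ (levelSet G c) M := by
  have hΦ := classGI_normalized hφ μ
  -- The values decrease, so `a 0` bounds every norm and one radius `R` serves the whole sequence.
  obtain ⟨a, ha_anti, ha_lim, ha_mem⟩ := exists_seq_tendsto_sInf
    (hne.image fun Q : ConvexBody (Space n) => orliczNorm μ φ (supportFn (Q : Set (Space n))))
    (bddBelow_orliczNorm_image μ φ _)
  choose Q hQ hQa using ha_mem
  have hnorm : ∀ i, luxemburg μ (fun t _ => 1 / μ.real univ * φ t)
      (supportFn (Q i : Set (Space n))) = a i := fun i => by
    rw [← orliczNorm_eq_luxemburg]; exact hQa i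
  have ha0 : 0 < a 0 := by
    rw [← hnorm 0]
    exact (luxemburg_spec hΦ (continuous_supportFn _) (supportFn_pos (hQ 0).1)).1
  obtain ⟨R, hR⟩ := exists_forall_subset_closedBall hφ hμ ha0 (μ.real univ)
  have hQR : ∀ i, (Q i : Set (Space n)) ⊆ Metric.closedBall 0 R := fun i => by
    refine hR _ (hQ i).1 ?_
    have h1 := (luxemburg_le_iff hΦ (continuous_supportFn (Q i)) (supportFn_pos (hQ i).1) ha0).1
      ((hnorm i).trans_le (ha_anti (Nat.zero_le i)))
    rw [integral_const_mul, one_div, inv_mul_le_iff₀ measureReal_univ_pos, mul_one] at h1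
    exact h1
  obtain ⟨M, ψ, hψ, hlim⟩ := exists_subseq_tendsto_convexBody hQR
  have hM : M ∈ bodiesO n := mem_bodiesO_iff.2 fun v =>
    supportFn_pos_of_tendsto hG hgr (fun i => (hQ (ψ i)).1) (fun i => (hQ (ψ i)).2) hlim v
  refine ⟨M, ⟨hM, ?_⟩, ?_⟩
  · refine tendsto_nhds_unique
      (tendsto_integral_of_tendsto hG (fun i => (hQ (ψ i)).1) hM hlim) ?_
    exact tendsto_const_nhds.congr fun i => ((hQ (ψ i)).2).symm
  · rw [orliczNorm_eq_luxemburg]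
    refine tendsto_nhds_unique ?_ (ha_lim.comp hψ.tendsto_atTop)
    refine (tendsto_luxemburg hΦ (fun i => continuous_supportFn (Q (ψ i)))
      (continuous_supportFn M) (supportFn_pos hM) hlim
      fun i u => abs_supportFn_sub_le_dist _ _ u).congr fun i => hnorm (ψ i)


/-! ### Uniqueness under convexity. -/

/-- At the common norm `s` the normalized integrals of `φ(f / s)` and `φ(g / s)` both equal `1`; by
convexity the midpoint's is at most their average. -/
theorem orliczNorm_midpoint_le {φ : ℝ → ℝ} (hφ : ClassI φ) (hconv : ConvexOn ℝ (Ioi 0) φ)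
    {μ : Measure (Sph n)} [IsFiniteMeasure μ] [NeZero μ] {f g : Sph n → ℝ} (hf : Continuous f)
    (hfpos : ∀ u, 0 < f u) (hg : Continuous g) (hgpos : ∀ u, 0 < g u)
    (hfg : orliczNorm μ φ f = orliczNorm μ φ g) :
    orliczNorm μ φ (fun u => 1 / 2 * (f u + g u)) ≤ orliczNorm μ φ f := by
  have hΦ := classGI_normalized hφ μ
  rw [orliczNorm_eq_luxemburg, orliczNorm_eq_luxemburg] at *
  set s := luxemburg μ (fun t _ => 1 / μ.real univ * φ t) f with hs
  obtain ⟨hs0, hs1⟩ := luxemburg_spec (ν := μ) hΦ hf hfpos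
  have hg1 := (luxemburg_spec (ν := μ) hΦ hg hgpos).2
  rw [← hs] at hs0 hs1
  rw [← hfg] at hg1
  have hpos : ∀ u, 0 < 1 / 2 * (f u + g u) := fun u => by linarith [hfpos u, hgpos u]
  have hc : Continuous fun u => 1 / 2 * (f u + g u) := by fun_prop
  have hif := hΦ.integrable_comp (ν := μ) (hf.div_const s) fun u => div_pos (hfpos u) hs0
  have hig := hΦ.integrable_comp (ν := μ) (hg.div_const s) fun u => div_pos (hgpos u) hs0
  rw [luxemburg_le_iff hΦ hc hpos hs0]
  have hk : 0 < 1 / μ.real univ := one_div_pos.2 measureReal_univ_pos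
  have hle := MeasureTheory.integral_mono
    (hΦ.integrable_comp (ν := μ) (hc.div_const s) fun u => div_pos (hpos u) hs0)
    ((hif.add hig).const_mul (1 / 2)) fun u => by
      have h1 := hconv.2 (mem_Ioi.2 (div_pos (hfpos u) hs0)) (mem_Ioi.2 (div_pos (hgpos u) hs0))
        (by norm_num : (0 : ℝ) ≤ 1 / 2) (by norm_num : (0 : ℝ) ≤ 1 / 2) (by norm_num)
      simp only [smul_eq_mul] at h1
      have h2 : 1 / 2 * (f u + g u) / s = 1 / 2 * (f u / s) + 1 / 2 * (g u / s) := by ring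
      have h3 := mul_le_mul_of_nonneg_left h1 hk.le
      simp only [Pi.add_apply, h2]
      linarith
  refine hle.trans_eq ?_
  rw [integral_const_mul, integral_add' hif hig, hs1, hg1]
  norm_num

theorem inv_midpoint_le {a b : ℝ} (ha : 0 < a) (hb : 0 < b) :
    (1 / 2 * (a + b))⁻¹ ≤ 1 / 2 * a⁻¹ + 1 / 2 * b⁻¹ := by
  rw [← sub_nonneg]
  have : 1 / 2 * a⁻¹ + 1 / 2 * b⁻¹ - (1 / 2 * (a + b))⁻¹ = (a - b) ^ 2 / (2 * a * b * (a + b)) := by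
    field_simp; ring
  rw [this]
  positivity

theorem inv_midpoint_lt {a b : ℝ} (ha : 0 < a) (hb : 0 < b) (hab : a ≠ b) :
    (1 / 2 * (a + b))⁻¹ < 1 / 2 * a⁻¹ + 1 / 2 * b⁻¹ := by
  rw [← sub_pos]
  have : 1 / 2 * a⁻¹ + 1 / 2 * b⁻¹ - (1 / 2 * (a + b))⁻¹ = (a - b) ^ 2 / (2 * a * b * (a + b)) := by
    field_simp; ring
  rw [this]
  have := sq_pos_of_ne_zero (sub_ne_zero.2 hab)
  positivity

/-- Strictness comes from `1 / t` and the strict monotonicity of `G(·, u)`, not from its convexity.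
It holds at one point where `f ≠ g`; continuity and the positivity of the measure on open sets carry
it to the integral. -/
theorem integral_inv_midpoint_lt {G : ℝ → Sph n → ℝ} (hG : ClassGI G)
    (hconv : ∀ u, ConvexOn ℝ (Ioi 0) fun t => G t u) {f g : Sph n → ℝ} (hf : Continuous f)
    (hfpos : ∀ u, 0 < f u) (hg : Continuous g) (hgpos : ∀ u, 0 < g u) (hne : f ≠ g) {c : ℝ}
    (hfc : ∫ u, G (f u)⁻¹ u ∂(sphMeasure n) = c) (hgc : ∫ u, G (g u)⁻¹ u ∂(sphMeasure n) = c) :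
    ∫ u, G (1 / 2 * (f u + g u))⁻¹ u ∂(sphMeasure n) < c := by
  have hcpos : ∀ u, 0 < 1 / 2 * (f u + g u) := fun u => by linarith [hfpos u, hgpos u]
  have hcont : ∀ {h : Sph n → ℝ}, Continuous h → (∀ u, 0 < h u) →
      Continuous fun u => G (h u)⁻¹ u := fun {h} hh hp =>
    hG.continuous_comp (hh.inv₀ fun u => (hp u).ne') fun u => inv_pos.2 (hp u)
  have hcf := hcont hf hfpos
  have hcg := hcont hg hgpos
  have hcm := hcont (h := fun u => 1 / 2 * (f u + g u)) (by fun_prop) hcpos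
  have hle2 : ∀ u, G (1 / 2 * (f u)⁻¹ + 1 / 2 * (g u)⁻¹) u ≤
      1 / 2 * G (f u)⁻¹ u + 1 / 2 * G (g u)⁻¹ u := fun u => by
    have := (hconv u).2 (mem_Ioi.2 (inv_pos.2 (hfpos u))) (mem_Ioi.2 (inv_pos.2 (hgpos u)))
      (by norm_num : (0 : ℝ) ≤ 1 / 2) (by norm_num : (0 : ℝ) ≤ 1 / 2) (by norm_num)
    simpa only [smul_eq_mul] using this
  obtain ⟨u₀, hu₀⟩ := Function.ne_iff.1 hne
  have hpos := Continuous.integral_pos_of_hasCompactSupport_nonneg_nonzero (μ := sphMeasure n)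
    (f := fun u => (1 / 2 * G (f u)⁻¹ u + 1 / 2 * G (g u)⁻¹ u) - G (1 / 2 * (f u + g u))⁻¹ u)
    (x := u₀) (((continuous_const.mul hcf).add (continuous_const.mul hcg)).sub hcm) (HasCompactSupport.of_compactSpace _)
    (fun u => sub_nonneg.2 ((hG.mono (inv_pos.2 (hcpos u))
      (inv_midpoint_le (hfpos u) (hgpos u)) u).trans (hle2 u)))
    (sub_pos.2 ((hG.strictMonoOn u₀ (mem_Ioi.2 (inv_pos.2 (hcpos u₀)))
      (mem_Ioi.2 ((inv_pos.2 (hcpos u₀)).trans_le (inv_midpoint_le (hfpos u₀) (hgpos u₀))))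
      (inv_midpoint_lt (hfpos u₀) (hgpos u₀) hu₀)).trans_le (hle2 u₀))).ne'
  have hif := (integrable_of_continuous (ν := sphMeasure n) hcf).const_mul (1 / 2)
  have hig := (integrable_of_continuous (ν := sphMeasure n) hcg).const_mul (1 / 2)
  have hiadd : Integrable (fun u => 1 / 2 * G (f u)⁻¹ u + 1 / 2 * G (g u)⁻¹ u)
    (sphMeasure n) := hif.add hig
  rw [integral_sub hiadd (integrable_of_continuous hcm), integral_add hif hig,
    integral_const_mul, integral_const_mul, hfc, hgc] at hpos
  linarith

theorem IsSolution.eq {φ : ℝ → ℝ} (hφ : ClassI φ) {μ : Measure (Sph n)}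
    [IsFiniteMeasure μ] [NeZero μ] {G : ℝ → Sph n → ℝ} (hG : ClassGI G)
    (hφconv : ConvexOn ℝ (Ioi 0) φ) (hGconv : ∀ u, ConvexOn ℝ (Ioi 0) fun t => G t u) {c : ℝ}
    {K L : ConvexBody (Space n)} (hK : IsSolution μ φ (levelSet G c) K)
    (hL : IsSolution μ φ (levelSet G c) L) : K = L := by
  by_contra hne
  obtain ⟨⟨hK0, hKc⟩, hKmin⟩ := hK
  obtain ⟨⟨hL0, hLc⟩, hLmin⟩ := hL
  have hKpos := supportFn_pos hK0
  have hLpos := supportFn_pos hL0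
  have hfun : supportFn (K : Set (Space n)) ≠ supportFn (L : Set (Space n)) := fun h =>
    hne (eq_of_supportFn_eq fun u => congrFun h u)
  obtain ⟨v, -⟩ := Function.ne_iff.1 hfun
  have : Nonempty (Sph n) := ⟨v⟩
  have : NeZero (sphMeasure n) := ⟨sphMeasure_ne_zero⟩
  set h : Sph n → ℝ := fun u =>
    1 / 2 * (supportFn (K : Set (Space n)) u + supportFn (L : Set (Space n)) u) with hh
  have hcont : Continuous h :=
    continuous_const.mul ((continuous_supportFn K).add (continuous_supportFn L))
  have hpos : ∀ u, 0 < h u := fun u => by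
    simp only [hh]; linarith [hKpos u, hLpos u]
  have hlt : ∫ u, G (h u)⁻¹ u ∂(sphMeasure n) < c :=
    integral_inv_midpoint_lt hG hGconv (continuous_supportFn K) hKpos (continuous_supportFn L)
      hLpos hfun hKc hLc
  have hc0 : 0 < c := lt_of_le_of_lt
    (integral_nonneg fun u => (hG.pos _ u (inv_pos.2 (hpos u))).le) hlt
  have hinv : Continuous fun u => (h u)⁻¹ := hcont.inv₀ fun u => (hpos u).ne'
  have hipos : ∀ u, 0 < (h u)⁻¹ := fun u => inv_pos.2 (hpos u)
  -- Scaling the midpoint body by `s` divides `1 / h` by `s`, so this `s` puts it back on the level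
  -- set; `s < 1` because the integral is below `c` at `s = 1`.
  obtain ⟨s, hs, hsc⟩ := hG.exists_integral_div_eq (ν := sphMeasure n) hinv hipos hc0
  have hs1 : s < 1 := by
    rw [← hG.integral_div_lt_iff (ν := sphMeasure n) hinv hipos one_pos hs]
    simpa only [div_one] using hlt.trans_eq hsc.symm
  let Q : ConvexBody (Space n) := s • ((1 / 2 : ℝ) • (K + L))
  have hQ : supportFn (Q : Set (Space n)) = fun u => s * h u := by
    funext u
    rw [supportFn_smul _ hs, supportFn_smul _ one_half_pos, supportFn_add]
  have hQmem : Q ∈ levelSet G c := by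
    refine ⟨mem_bodiesO_iff.2 fun u => ?_, ?_⟩
    · rw [hQ]; exact mul_pos hs (hpos u)
    · rw [hQ, ← hsc]
      refine congrArg (fun F : Sph n → ℝ => ∫ u, F u ∂(sphMeasure n)) (funext fun u => ?_)
      rw [mul_inv, div_eq_inv_mul]
  have hmin : orliczNorm μ φ (supportFn (K : Set (Space n))) ≤
      orliczNorm μ φ (supportFn (Q : Set (Space n))) :=
    hKmin.trans_le (csInf_le (bddBelow_orliczNorm_image μ φ _) ⟨Q, hQmem, rfl⟩)
  have hmid : orliczNorm μ φ h ≤ orliczNorm μ φ (supportFn (K : Set (Space n))) :=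
    orliczNorm_midpoint_le hφ hφconv (continuous_supportFn K) hKpos (continuous_supportFn L)
      hLpos (hKmin.trans hLmin.symm)
  have hΦ := classGI_normalized hφ μ
  have hscale : orliczNorm μ φ (supportFn (Q : Set (Space n))) = s * orliczNorm μ φ h := by
    rw [orliczNorm_eq_luxemburg, orliczNorm_eq_luxemburg, hQ]
    exact luxemburg_const_mul hΦ hcont hpos hs
  have hnorm : 0 < orliczNorm μ φ h := by
    rw [orliczNorm_eq_luxemburg]; exact (luxemburg_spec hΦ hcont hpos).1
  -- With `N` the norm, `N(K) ≤ N(Q) = s N(h) < N(h) ≤ N(K)`.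
  nlinarith

/-! ### Both constraints as level sets, and the conclusion. -/

theorem constraintTilde_eq (G : ℝ → Sph n → ℝ) :
    constraintTilde G = levelSet G (∫ u, G 1 u ∂(sphMeasure n)) := by
  ext Q
  refine and_congr_right fun hQ => ?_
  simp only [dualVol, radialFn_polarBody hQ, radialFn_closedBall]

theorem unitBall_mem_levelSet (G : ℝ → Sph n → ℝ) :
    unitBall n ∈ levelSet G (∫ u, G 1 u ∂(sphMeasure n)) :=
  ⟨unitBall_mem_bodiesO, by simp only [supportFn_unitBall, inv_one]⟩

/-- Here `s` is the Luxemburg functional of the constant `1`, which is the homogeneous dual volume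
of the ball. The level is equal to `1`, but is written as an integral so that
`unitBall_mem_levelSet` applies to the rescaled `G`. -/
theorem constraintHat_eq [Nonempty (Sph n)] {G : ℝ → Sph n → ℝ} (hG : ClassGI G) :
    ∃ s, 0 < s ∧ constraintHat G =
      levelSet (fun t u => G (t / s) u) (∫ u, G (1 / s) u ∂(sphMeasure n)) := by
  have : NeZero (sphMeasure n) := ⟨sphMeasure_ne_zero⟩
  obtain ⟨hs, hs1⟩ := luxemburg_spec (ν := sphMeasure n) (f := fun _ => 1) hG continuous_const
    fun _ => one_pos
  refine ⟨_, hs, ?_⟩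
  ext Q
  refine and_congr_right fun hQ => ?_
  rw [hs1, ← luxemburg_eq_iff (f := fun u => (supportFn (Q : Set (Space n)) u)⁻¹) hG
    ((continuous_supportFn Q).inv₀ fun u => (supportFn_pos hQ u).ne')
    (fun u => inv_pos.2 (supportFn_pos hQ u)) hs]
  simp only [homDualVol, luxemburg, radialFn_polarBody hQ, radialFn_closedBall]

end DualPolarOrlicz

theorem mainTheorem6 {n : ℕ} (φ : ℝ → ℝ) (hφ : DualPolarOrlicz.ClassI φ)
    (μ : Measure (DualPolarOrlicz.Sph n)) [IsFiniteMeasure μ] (hμ0 : μ ≠ 0)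
    (hμ : DualPolarOrlicz.NotConcentratedOnHemisphere μ)
    (G : ℝ → DualPolarOrlicz.Sph n → ℝ) (hG : DualPolarOrlicz.ClassGI G)
    (q : ℝ) (hq : (n : ℝ) - 1 ≤ q) (hGq : DualPolarOrlicz.GrowthCondition G q) :
    ((∃ M : ConvexBody (DualPolarOrlicz.Space n),
        DualPolarOrlicz.IsSolution μ φ (DualPolarOrlicz.constraintTilde G) M) ∧
      (ConvexOn ℝ (Ioi 0) φ → (∀ u, ConvexOn ℝ (Ioi 0) (fun t => G t u)) →
        ∃! M : ConvexBody (DualPolarOrlicz.Space n),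
          DualPolarOrlicz.IsSolution μ φ (DualPolarOrlicz.constraintTilde G) M)) ∧
    ((∃ M : ConvexBody (DualPolarOrlicz.Space n),
        DualPolarOrlicz.IsSolution μ φ (DualPolarOrlicz.constraintHat G) M) ∧
      (ConvexOn ℝ (Ioi 0) φ → (∀ u, ConvexOn ℝ (Ioi 0) (fun t => G t u)) →
        ∃! M : ConvexBody (DualPolarOrlicz.Space n),
          DualPolarOrlicz.IsSolution μ φ (DualPolarOrlicz.constraintHat G) M)) := by

  have : NeZero μ := ⟨hμ0⟩
  -- A nonzero measure needs a nonempty sphere, which excludes `n = 0`.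
  have hne : Nonempty (DualPolarOrlicz.Sph n) := by
    by_contra h
    rw [not_nonempty_iff] at h
    exact hμ0 (Measure.eq_zero_of_isEmpty μ)
  have hn : n ≠ 0 := by
    rintro rfl
    obtain ⟨v⟩ := hne
    exact absurd v.2 (by simp [Subsingleton.elim (v : DualPolarOrlicz.Space 0) 0])
  have hgr := hGq.powGrowth hG hn hq
  constructor
  · rw [DualPolarOrlicz.constraintTilde_eq]
    obtain ⟨M, hM⟩ := DualPolarOrlicz.exists_isSolution_levelSet hφ hμ hG hgr
      ⟨_, DualPolarOrlicz.unitBall_mem_levelSet G⟩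
    exact ⟨⟨M, hM⟩, fun hφc hGc => ⟨M, hM, fun K hK => hK.eq hφ hG hφc hGc hM⟩⟩
  · obtain ⟨s, hs, heq⟩ := DualPolarOrlicz.constraintHat_eq hG
    rw [heq]
    have hG' := hG.comp_div hs
    obtain ⟨M, hM⟩ := DualPolarOrlicz.exists_isSolution_levelSet hφ hμ hG' (hgr.comp_div hs)
      ⟨_, DualPolarOrlicz.unitBall_mem_levelSet _⟩
    refine ⟨⟨M, hM⟩, fun hφc hGc => ⟨M, hM, fun K hK => hK.eq hφ hG' hφc (fun u => ?_) hM⟩⟩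
    refine ⟨convex_Ioi 0, fun x hx y hy a b ha hb hab => ?_⟩
    have := (hGc u).2 (mem_Ioi.2 (div_pos hx hs)) (mem_Ioi.2 (div_pos hy hs)) ha hb hab
    simp only [smul_eq_mul] at this ⊢
    rwa [add_div, mul_div_assoc, mul_div_assoc]
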